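/- **Definitions.** For a permutation $\sigma$ of $\{1,\dots,n\}$ let $\mathrm{maj}(\sigma)=\sum_{1\le i\le n-1,\ \sigma(i)>\sigma(i+1)} i$ and $\mathrm{exc}(\sigma)=|\{i:\sigma(i)>i\}|$. Let $$A_n(q,t)=\sum_{\sigma\in\mathfrak S_n}q^{\mathrm{maj}(\sigma)-\mathrm{exc}(\sigma)}t^{\mathrm{exc}(\sigma)}\quad(n\ge1),\qquad A_0(q,t)=1,$$ $$\tilde A_n(q,t)=1+t\sum_{m=1}^n\binom nm_q A_m(q,t)\quad(n\ge0),$$ where $\binom nm_q=\frac{[n]_q!}{[m]_q!\,[n-m]_q!}$, $[n]_q!=\prod_{j=1}^n[j]_q$ and $[j]_q=1+q+\dots+q^{j-1}$. Let $R$ be a commutative ring (for instance $\mathbb Z$ or $\mathbb R$) and let $\Lambda$ be the $R$-algebra of symmetric functions in $\mathbf x=(x_1,x_2,\dots)$, that is, of the formal power series of bounded degree over $R$ that are invariant under all permutations of the variables. Let $h_n(\mathbf x)\in\Lambda$ be the complete homogeneous symmetric function of degree $n$ and $H(z)=\sum_{n\ge0}h_n(\mathbf x)z^n$. Let $Q_n(\mathbf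 x,t)\in\Lambda[t]$ be defined by $$\sum_{n\ge0}Q_n(\mathbf x,t)z^n=\frac{(1-t)H(z)}{H(tz)-tH(z)},$$ that is, as the coefficients of the unique power series in $z$ over $\Lambda[t]$ whose product with $H(tz)-tH(z)$ is $(1-t)H(z)$, and let $$\tilde Q_n(\mathbf x,t)=h_n(\mathbf x)+t\sum_{m=1}^n h_{n-m}(\mathbf x)\,Q_m(\mathbf x,t)\quad(n\ge0).$$ The stable principal specialization of $G\in\Lambda$ is $\mathrm{ps}_q(G)=G(1,q,q^2,\dots)\in R[[q]]$, obtained by replacing each $x_i$ by $q^{i-1}$; it is extended to $\Lambda[t]$ by $\mathrm{ps}_q\big(\sum_i G_i(\mathbf x)t^i\big)=\sum_i\mathrm{ps}_q(G_i)\,t^i\in R[[q]][t]$. **Corollary.** For all $n\ge0$, $$\mathrm{ps}_q\big(\tilde Q_n(\mathbf x,t)\big)=\frac{\tilde A_n(q,t)}{(1-q)(1-q^2)\cdots(1-q^n)}\quad\text{in } R[[q]][t].$$ -/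

import Mathlib

noncomputable section

namespace EulerianSym

/-! ### Permutation statistics and `q`-Eulerian polynomials

A permutation of `[n]` is a term of `Equiv.Perm (Fin n)`: the position `i : Fin n`
stands for the number `i + 1` of `[n] = {1, …, n}`. -/

/-- The descent set: the positions `i` that have a next position and satisfy
`σ (i) > σ (i + 1)`. -/
def descents {n : ℕ} (σ : Equiv.Perm (Fin n)) : Finset (Fin n) :=
  {i : Fin n | ∃ h : (i : ℕ) + 1 < n, σ ⟨i + 1, h⟩ < σ i}

/-- The major index, the sum of the descents (each `i : Fin n` counted as `i + 1`). -/
def maj {n : ℕ} (σ : Equiv.Perm (Fin n)) : ℕ := ∑ i ∈ descents σ, ((i : ℕ) + 1)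

/-- The excedances of `σ`. -/
def excedances {n : ℕ} (σ : Equiv.Perm (Fin n)) : Finset (Fin n) := {i : Fin n | i < σ i}

/-- The excedance number. -/
def exc {n : ℕ} (σ : Equiv.Perm (Fin n)) : ℕ := (excedances σ).card

/-- The difference `maj σ - exc σ`, which is the exponent of `q` below, is never truncated. -/
theorem exc_le_maj {n : ℕ} (σ : Equiv.Perm (Fin n)) : exc σ ≤ maj σ := by
  rcases (excedances σ).eq_empty_or_nonempty with h | h
  · simp [exc, h]
  obtain ⟨i, hi, hmax⟩ := (excedances σ).exists_max_image id h
  have hlt : i < σ i := by simpa [excedances] using hi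
  have hd : ∃ d ∈ descents σ, i ≤ d := by
    by_contra! hno
    have key : ∀ k : ℕ, ∀ hk : (i : ℕ) + k < n, (σ i : ℕ) + k ≤ σ ⟨i + k, hk⟩ := by
      intro k
      induction k with
      | zero => intro hk; simp
      | succ k ih =>
        intro hk
        have hk' : (i : ℕ) + k < n := by omega
        have h1 := ih hk'
        have h2 : (⟨i + k, hk'⟩ : Fin n) ∉ descents σ := fun hc => by
          have := hno _ hc
          rw [Fin.lt_def] at this
          simp at this
        simp only [descents, Finset.mem_filter, Finset.mem_univ, true_and, not_exists,
          not_lt] at h2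
        have h3 := h2 (by omega)
        have h4 : σ ⟨i + k, hk'⟩ ≠ σ ⟨i + k + 1, by omega⟩ := by
          intro hc
          have := σ.injective hc
          simp at this
        have h5 := lt_of_le_of_ne h3 h4
        rw [Fin.lt_def] at h5
        have h6 : (⟨i + (k + 1), hk⟩ : Fin n) = ⟨i + k + 1, by omega⟩ := by
          ext; simp; omega
        rw [h6]
        omega
    have hn := i.isLt
    have h1 := key (n - 1 - i) (by omega)
    have h2 := (σ ⟨i + (n - 1 - i), by omega⟩).isLt
    rw [Fin.lt_def] at hlt
    omega
  obtain ⟨d, hd, hid⟩ := hd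
  have h1 : exc σ ≤ (i : ℕ) + 1 := by
    have : excedances σ ⊆ Finset.Iic i := fun j hj => by simpa using hmax j hj
    simpa [exc] using Finset.card_le_card this
  have h2 : (d : ℕ) + 1 ≤ maj σ :=
    Finset.single_le_sum (f := fun i : Fin n => (i : ℕ) + 1) (fun _ _ => Nat.zero_le _) hd
  rw [Fin.le_def] at hid
  omega

section Polynomials

open Polynomial

variable (R : Type*) [CommRing R]

/-- The `q`-Eulerian polynomial `A_n(q,t) = ∑_σ q^(maj σ - exc σ) t^(exc σ)`, an element of
`R[q][t]`; the outer variable is `t`. For `n = 0` it is `1`. -/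
def qEulerian (n : ℕ) : R[X][X] :=
  ∑ σ : Equiv.Perm (Fin n), C (X ^ (maj σ - exc σ)) * X ^ exc σ

/-- `[n]_q = 1 + q + ⋯ + q^(n-1)`. -/
def qNat (n : ℕ) : R[X] := ∑ i ∈ Finset.range n, X ^ i

/-- `[n]_q! = [1]_q [2]_q ⋯ [n]_q`. -/
def qFactorial (n : ℕ) : R[X] := ∏ j ∈ Finset.Icc 1 n, qNat R j

/-- The `q`-binomial coefficient, the quotient of `[n]_q!` by the monic polynomial
`[k]_q! [n-k]_q!` in `R[q]` for `k ≤ n`, and `0` otherwise. -/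
def qBinomial (n k : ℕ) : R[X] :=
  if k ≤ n then qFactorial R n /ₘ (qFactorial R k * qFactorial R (n - k)) else 0

theorem qFactorial_succ (n : ℕ) :
    qFactorial R (n + 1) = qFactorial R n * qNat R (n + 1) := by
  rw [qFactorial, Finset.prod_Icc_succ_top (by omega)]; rfl

theorem qNat_add (a b : ℕ) : qNat R (a + b) = qNat R a + X ^ a * qNat R b := by
  simp [qNat, Finset.sum_range_add, Finset.mul_sum, pow_add]

theorem qFactorial_mul_dvd (a b : ℕ) :
    qFactorial R a * qFactorial R b ∣ qFactorial R (a + b) := by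
  induction h : a + b generalizing a b with
  | zero =>
    obtain ⟨rfl, rfl⟩ : a = 0 ∧ b = 0 := by omega
    simp [qFactorial]
  | succ n ih =>
    rcases a with _ | a
    · obtain rfl : b = n + 1 := by omega
      simp [qFactorial]
    rcases b with _ | b
    · obtain rfl : a = n := by omega
      simp [qFactorial]
    have h1 := ih (a + 1) b (by omega)
    have h2 := ih a (b + 1) (by omega)
    rw [qFactorial_succ R n, show n + 1 = (a + 1) + (b + 1) by omega, qNat_add, mul_add]
    refine dvd_add ?_ ?_
    · rw [qFactorial_succ R a, mul_right_comm]
      exact mul_dvd_mul h2 dvd_rfl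
    · rw [qFactorial_succ R b, ← mul_assoc, mul_left_comm (qFactorial R n)]
      exact Dvd.dvd.mul_left (mul_dvd_mul h1 dvd_rfl) _

theorem qNat_monic (n : ℕ) : (qNat R (n + 1)).Monic := by
  nontriviality R
  exact monic_geom_sum_X (by omega)

theorem qFactorial_monic (n : ℕ) : (qFactorial R n).Monic := by
  refine monic_prod_of_monic _ _ fun j hj => ?_
  obtain ⟨m, rfl⟩ : ∃ m, j = m + 1 := ⟨j - 1, by have := (Finset.mem_Icc.1 hj).1; omega⟩
  exact qNat_monic R m

/-- The division in `qBinomial` is exact. -/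
theorem qBinomial_mul {n k : ℕ} (hk : k ≤ n) :
    qBinomial R n k * (qFactorial R k * qFactorial R (n - k)) = qFactorial R n := by
  have hd := qFactorial_mul_dvd R k (n - k)
  have hm := (qFactorial_monic R k).mul (qFactorial_monic R (n - k))
  rw [Nat.add_sub_cancel' hk] at hd
  have h := modByMonic_add_div (qFactorial R n) (qFactorial R k * qFactorial R (n - k))
  rw [(modByMonic_eq_zero_iff_dvd hm).2 hd, zero_add] at h
  rw [qBinomial, if_pos hk, mul_comm, h]

/-- The `q`-binomial-Eulerian polynomial
`Ã_n(q,t) = 1 + t ∑_{m=1}^n (n choose m)_q A_m(q,t)` in `R[q][t]`. -/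
def qBinomialEulerian (n : ℕ) : R[X][X] :=
  1 + X * ∑ m ∈ Finset.Icc 1 n, C (qBinomial R n m) * qEulerian R m

end Polynomials

/-! ### Symmetric functions -/

section SymmetricFunctions

variable (R : Type*) [CommRing R]

/-- The algebra `Λ` of symmetric functions over `R` in `x_0, x_1, x_2, …`: the formal power
series of bounded degree that are fixed by every permutation of the variables. -/
def SymFun : Subalgebra R (MvPowerSeries ℕ R) where
  carrier := {f | (∃ d : ℕ, ∀ m : ℕ →₀ ℕ, d < m.degree → MvPowerSeries.coeff m f = 0) ∧
    ∀ e : Equiv.Perm ℕ, MvPowerSeries.renameEquiv R e f = f}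
  mul_mem' := by
    classical
    rintro f g ⟨⟨d, hd⟩, hf⟩ ⟨⟨d', hd'⟩, hg⟩
    refine ⟨⟨d + d', fun m hm => ?_⟩, fun e => by rw [map_mul, hf, hg]⟩
    rw [MvPowerSeries.coeff_mul]
    refine Finset.sum_eq_zero fun p hp => ?_
    have h : p.1.degree + p.2.degree = m.degree := by
      rw [← Finset.HasAntidiagonal.mem_antidiagonal.1 hp, map_add]
    rcases lt_or_ge d p.1.degree with h1 | h1
    · rw [hd _ h1, zero_mul]
    · rw [hd' _ (by omega), mul_zero]
  add_mem' := by
    rintro f g ⟨⟨d, hd⟩, hf⟩ ⟨⟨d', hd'⟩, hg⟩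
    refine ⟨⟨d + d', fun m hm => ?_⟩, fun e => by rw [map_add, hf, hg]⟩
    rw [map_add, hd _ (by omega), hd' _ (by omega), add_zero]
  algebraMap_mem' := by
    classical
    intro r
    refine ⟨⟨0, fun m hm => ?_⟩, fun e => AlgEquiv.commutes _ r⟩
    rw [MvPowerSeries.algebraMap_apply, Algebra.algebraMap_self_apply, MvPowerSeries.coeff_C,
      if_neg]
    rintro rfl
    simp at hm

/-- The complete homogeneous symmetric function `h_n`, the sum of all monomials of degree `n`. -/
def h (n : ℕ) : SymFun R :=
  ⟨fun m => if m.degree = n then 1 else 0, by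
    refine ⟨⟨n, fun m hm => if_neg (by omega)⟩, fun e => ?_⟩
    ext m
    obtain ⟨m, rfl⟩ : ∃ m', m = Finsupp.embDomain e.toEmbedding m' :=
      ⟨Finsupp.equivMapDomain e.symm m, by
        ext i
        conv_rhs => rw [show i = e.toEmbedding (e.symm i) by simp, Finsupp.embDomain_apply_self]
        simp⟩
    have h1 : (Finsupp.embDomain e.toEmbedding m).degree = m.degree := by
      rw [Finsupp.degree_apply, Finsupp.degree_apply]
      rw [Finsupp.support_embDomain, Finset.sum_map]
      exact Finset.sum_congr rfl fun i _ => Finsupp.embDomain_apply_self _ _ _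
    refine (MvPowerSeries.coeff_embDomain_rename e.toEmbedding _ m).trans ?_
    change (if _ then _ else _) = if _ then _ else _
    rw [h1]⟩

/-- The stable principal specialization `G ↦ G(1, q, q^2, …)`: the monomial `∏ x_i ^ m_i` becomes
`q ^ (∑ m_i * i)`, so the coefficient of `q^k` is the sum of the coefficients of `G` at all
the monomials with `∑ m_i * i = k`. -/
def ps (G : SymFun R) : PowerSeries R :=
  PowerSeries.mk fun k =>
    ∑ᶠ (m : ℕ →₀ ℕ) (_ : m.sum (fun i a => a * i) = k), MvPowerSeries.coeff m (G : MvPowerSeries ℕ R)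

/-- The sums in `ps` are finite. -/
theorem ps_finite (G : SymFun R) (k : ℕ) :
    {m : ℕ →₀ ℕ | m.sum (fun i a => a * i) = k ∧
      MvPowerSeries.coeff m (G : MvPowerSeries ℕ R) ≠ 0}.Finite := by
  obtain ⟨⟨d, hd⟩, -⟩ := G.2
  refine (Finset.finite_toSet
    (Finset.finsupp (Finset.range (k + 1)) fun _ => Finset.range (d + 1))).subset ?_
  rintro m ⟨hm, hG⟩
  have hdeg : m.degree ≤ d := not_lt.1 fun hc => hG (hd m hc)
  rw [Finset.mem_coe, Finset.mem_finsupp_iff]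
  constructor
  · intro i hi
    have h1 : m i * i ≤ m.sum (fun i a => a * i) :=
      Finset.single_le_sum (f := fun i => m i * i) (fun _ _ => Nat.zero_le _) hi
    have h2 : 1 ≤ m i := Nat.one_le_iff_ne_zero.2 (Finsupp.mem_support_iff.1 hi)
    rw [Finset.mem_range]
    nlinarith
  · intro i _
    have := Finsupp.le_degree i m
    rw [Finset.mem_range]
    omega

/-- The coefficientwise extension of `ps` to polynomials in `t` over `Λ`. -/
def psPoly (P : Polynomial (SymFun R)) : Polynomial (PowerSeries R) :=
  P.sum fun i G => Polynomial.monomial i (ps R G)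

theorem existsUnique_quotient {S : Type*} [CommRing S] (a : ℕ → S) (h0 : a 0 = 1) :
    ∃! Q : PowerSeries (Polynomial S),
      (PowerSeries.rescale Polynomial.X (PowerSeries.mk fun n => Polynomial.C (a n)) -
        PowerSeries.C Polynomial.X * (PowerSeries.mk fun n => Polynomial.C (a n))) * Q =
      PowerSeries.C (1 - Polynomial.X) * (PowerSeries.mk fun n => Polynomial.C (a n)) := by
  set H : PowerSeries (Polynomial S) := PowerSeries.mk fun n => Polynomial.C (a n) with hH
  set D : PowerSeries (Polynomial S) := PowerSeries.mk fun n =>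
    Polynomial.C (a n) * (if n = 0 then 1 else
      -(Polynomial.X * ∑ i ∈ Finset.range (n - 1), Polynomial.X ^ i)) with hD
  have hfac : PowerSeries.rescale Polynomial.X H - PowerSeries.C Polynomial.X * H =
      PowerSeries.C (1 - Polynomial.X) * D := by
    ext1 n
    rw [map_sub, PowerSeries.coeff_C_mul, PowerSeries.coeff_C_mul,
      PowerSeries.coeff_rescale, hH, hD, PowerSeries.coeff_mk, PowerSeries.coeff_mk]
    rcases n with _ | n
    · simp; ring
    · have := mul_neg_geom_sum (Polynomial.X : Polynomial S) n
      simp only [Nat.add_one_ne_zero, if_false, Nat.add_sub_cancel]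
      linear_combination Polynomial.X * Polynomial.C (a (n + 1)) * this
  have hD0 : PowerSeries.constantCoeff D = ((1 : (Polynomial S)ˣ) : Polynomial S) := by
    rw [← PowerSeries.coeff_zero_eq_constantCoeff_apply, hD, PowerSeries.coeff_mk]
    simp [h0]
  have hinv := PowerSeries.mul_invOfUnit D 1 hD0
  have hreg : ∀ P P' : PowerSeries (Polynomial S),
      PowerSeries.C (1 - Polynomial.X) * P = PowerSeries.C (1 - Polynomial.X) * P' → P = P' := by
    intro P P' hP
    ext1 n
    have h1 := congrArg (PowerSeries.coeff n) hP
    rw [PowerSeries.coeff_C_mul, PowerSeries.coeff_C_mul] at h1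
    have hm : (Polynomial.X - Polynomial.C (1 : S)).Monic := Polynomial.monic_X_sub_C 1
    refine hm.isRegular.left ?_
    simp only [map_one]
    linear_combination -h1
  refine ⟨PowerSeries.invOfUnit D 1 * H, ?_, fun Q hQ => ?_⟩
  · beta_reduce
    rw [hfac]
    linear_combination PowerSeries.C (1 - Polynomial.X) * H * hinv
  · beta_reduce at hQ
    rw [hfac, mul_assoc] at hQ
    have h1 := hreg _ _ hQ
    linear_combination PowerSeries.invOfUnit D 1 * h1 - Q * hinv

/-- `H(z) = ∑ h_n z^n`, as a power series in `z` over `Λ[t]`. -/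
def H : PowerSeries (Polynomial (SymFun R)) := PowerSeries.mk fun n => Polynomial.C (h R n)

/-- `H(tz)`. -/
def Htz : PowerSeries (Polynomial (SymFun R)) := PowerSeries.rescale Polynomial.X (H R)

/-- Exactly one power series `Q` in `z` over `Λ[t]` equals `(1 - t) H(z) / (H(tz) - t H(z))`, in
the sense that `(H(tz) - t H(z)) Q = (1 - t) H(z)`. -/
theorem existsUnique_Q : ∃! Q : PowerSeries (Polynomial (SymFun R)),
    (Htz R - PowerSeries.C Polynomial.X * H R) * Q =
      PowerSeries.C (1 - Polynomial.X) * H R := by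
  refine existsUnique_quotient (h R) (Subtype.ext ?_)
  classical
  ext m
  rw [OneMemClass.coe_one, MvPowerSeries.coeff_one]
  change (if m.degree = 0 then (1 : R) else 0) = _
  simp [Finsupp.degree_eq_zero_iff]

/-- The generating function `∑ Q_n(x,t) z^n = (1 - t) H(z) / (H(tz) - t H(z))`. -/
def QSeries : PowerSeries (Polynomial (SymFun R)) := (existsUnique_Q R).choose

/-- The symmetric function polynomial `Q_n(x,t)` in `Λ[t]`. -/
def Q (n : ℕ) : Polynomial (SymFun R) := PowerSeries.coeff n (QSeries R)

/-- `Q̃_n(x,t) = h_n + t ∑_{m=1}^n h_{n-m} Q_m(x,t)` in `Λ[t]`. -/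
def Qtilde (n : ℕ) : Polynomial (SymFun R) :=
  Polynomial.C (h R n) +
    Polynomial.X * ∑ m ∈ Finset.Icc 1 n, Polynomial.C (h R (n - m)) * Q R m

/-- `(1 - q) (1 - q^2) ⋯ (1 - q^n)` as a power series in `q`. -/
def qPochhammer (n : ℕ) : PowerSeries R := ∏ i ∈ Finset.Icc 1 n, (1 - PowerSeries.X ^ i)

/-- `1 / ((1 - q) (1 - q^2) ⋯ (1 - q^n))` as a power series in `q`. -/
def qPochhammerInv (n : ℕ) : PowerSeries R := PowerSeries.invOfUnit (qPochhammer R n) 1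

theorem qPochhammer_mul_inv (n : ℕ) : qPochhammer R n * qPochhammerInv R n = 1 := by
  refine PowerSeries.mul_invOfUnit _ _ ?_
  rw [qPochhammer, map_prod]
  refine Finset.prod_eq_one fun i hi => ?_
  have : i ≠ 0 := by have := (Finset.mem_Icc.1 hi).1; omega
  simp [this]

end SymmetricFunctions

end EulerianSym

end

/-! Write `E(z) = ∑ z^n / ((1-q)⋯(1-q^n))`. The specialization `ps` is a ring homomorphism sending
`h_n` to the coefficient of `z^n` in `E`. It therefore carries the defining equation of `∑ Q_n z^n`
to the same equation with `E` in place of `H`, whose solution is unique (`existsUnique_quotient`).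
So it suffices that `N(z) = ∑ A_n(q,t) z^n / ((1-q)⋯(1-q^n))` satisfies `(E(tz) - t E(z)) N(z) =
(1-t) E(z)`. Passing from `Q_n` to `Q̃_n` is then the factorial formula for the q-binomial
coefficients.

The equation is checked modulo `q^(M+1)` for every `M`. There `E(z)` is the reciprocal of the finite
product of the `1 - q^k z` with `k ≤ M`, and `N` becomes a count of pairs: a permutation `σ`
weighted by `t^exc`, with a weakly increasing sequence `s` forced to be strict on a modified descent
set `dexSet σ`. The sum of that set is `maj σ - exc σ` (`sum_dexSet_add_exc`), and summing over the
gaps of `s` produces the denominator (`sum_compat_mul`).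

A pair `(σ, s)` is the same as a word: position `σ i` receives the letter `s i`, flagged by whether
`i` is an excedance, and `σ` is recovered as the stable sort of the word (`compat_dexSet_iff_sort`).
The consistency of the flags can be tested one letter at a time once the content `a` of the word is
known (`excedance_iff_local`). Hence the words of content `a` are counted by the coefficient of
`y^a` in a product of linear forms, `a_k` of them for each letter `k` (`sum_words_with_content`).

Summing such diagonal coefficients over all `a` is a MacMahon master theorem type problem.
`sum_blockCoeff_mul` solves it by eliminating one variable at a time with a one-variable
Lagrange-type summation (`lagrangeSum_eq`). The result is `(1-t) ∏(1-tξ_k z) / (∏(1-ξ_k z) - t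
∏(1-tξ_k z))`, which is the required quotient after multiplying numerator and denominator by `E(z)
E(tz)`. -/

noncomputable section

namespace EulerianSym

/-! ### The principal specialization -/

section PrincipalSpecialization

open Finset

variable (R : Type*) [CommRing R]

/-- The exponent of `q` in the principal specialization of the monomial `x^m`. -/
def wt (m : ℕ →₀ ℕ) : ℕ := m.sum fun i a => a * i

theorem wt_add (a b : ℕ →₀ ℕ) : wt (a + b) = wt a + wt b :=
  Finsupp.sum_add_index' (fun _ => zero_mul _) fun _ _ _ => add_mul _ _ _

/-- The exponents with all entries at most `d`, supported on `{0, …, k}`. -/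
def expBox (d k : ℕ) : Finset (ℕ →₀ ℕ) :=
  Finset.finsupp (range (k + 1)) fun _ => range (d + 1)

theorem mem_expBox {d k : ℕ} {m : ℕ →₀ ℕ} (hd : m.degree ≤ d) (hk : wt m ≤ k) :
    m ∈ expBox d k := by
  rw [expBox, mem_finsupp_iff]
  constructor
  · intro i hi
    have h1 : m i * i ≤ wt m :=
      single_le_sum (f := fun i => m i * i) (fun _ _ => Nat.zero_le _) hi
    have h2 : 1 ≤ m i := Nat.one_le_iff_ne_zero.2 (Finsupp.mem_support_iff.1 hi)
    rw [mem_range]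
    nlinarith
  · intro i _
    have := Finsupp.le_degree i m
    rw [mem_range]
    omega

variable {R}

/-- Replaces the `finsum` by a sum over a finite box. The bounds `d` and `k` may be larger than
needed, so that several specializations can be computed over one common box. -/
theorem coeff_ps (G : SymFun R) {d k k' : ℕ}
    (hd : ∀ m : ℕ →₀ ℕ, d < m.degree → MvPowerSeries.coeff m (G : MvPowerSeries ℕ R) = 0)
    (hk : k' ≤ k) : PowerSeries.coeff k' (ps R G) =
      ∑ m ∈ expBox d k with wt m = k', MvPowerSeries.coeff m (G : MvPowerSeries ℕ R) := by
  rw [ps, PowerSeries.coeff_mk]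
  refine finsum_mem_eq_sum_of_inter_support_eq (s := {m : ℕ →₀ ℕ | wt m = k'}) _ ?_
  ext m
  simp only [Set.mem_inter_iff, Set.mem_ofPred_eq, Function.mem_support, mem_coe, mem_filter]
  constructor
  · rintro ⟨h1, h2⟩
    exact ⟨⟨mem_expBox (not_lt.1 fun hc => h2 (hd m hc)) (by omega), h1⟩, h2⟩
  · rintro ⟨⟨_, h1⟩, h2⟩
    exact ⟨h1, h2⟩

theorem ps_add (G G' : SymFun R) : ps R (G + G') = ps R G + ps R G' := by
  obtain ⟨⟨d, hd⟩, -⟩ := G.2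
  obtain ⟨⟨d', hd'⟩, -⟩ := G'.2
  ext k
  rw [map_add, coeff_ps G (d := d + d') (fun m hm => hd m (by omega)) le_rfl,
    coeff_ps G' (d := d + d') (fun m hm => hd' m (by omega)) le_rfl,
    coeff_ps (G + G') (d := d + d') _ le_rfl, ← sum_add_distrib]
  · rfl
  · intro m hm
    change MvPowerSeries.coeff m ((G : MvPowerSeries ℕ R) + (G' : MvPowerSeries ℕ R)) = 0
    rw [map_add, hd m (by omega), hd' m (by omega), add_zero]

/-- Both sides sum over pairs of exponents `(a, b)` of total weight `k`, grouped by `a + b` on the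
left and by `(wt a, wt b)` on the right. The finite ranges differ only in pairs whose term vanishes,
by the degree bounds. -/
theorem ps_mul (G G' : SymFun R) : ps R (G * G') = ps R G * ps R G' := by
  classical
  obtain ⟨⟨d, hd⟩, -⟩ := G.2
  obtain ⟨⟨d', hd'⟩, -⟩ := G'.2
  have hmul : ∀ m, MvPowerSeries.coeff m ((G * G' : SymFun R) : MvPowerSeries ℕ R) =
      ∑ p ∈ antidiagonal m, MvPowerSeries.coeff p.1 (G : MvPowerSeries ℕ R) *
        MvPowerSeries.coeff p.2 (G' : MvPowerSeries ℕ R) := fun m => by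
    change MvPowerSeries.coeff m ((G : MvPowerSeries ℕ R) * (G' : MvPowerSeries ℕ R)) = _
    rw [MvPowerSeries.coeff_mul]
  ext k
  rw [PowerSeries.coeff_mul, coeff_ps (G * G') (d := d + d') _ le_rfl]
  · have h1 : ∀ p ∈ antidiagonal k, PowerSeries.coeff p.1 (ps R G) *
        PowerSeries.coeff p.2 (ps R G') =
        ∑ c ∈ expBox (d + d') k ×ˢ expBox (d + d') k with (wt c.1, wt c.2) = p,
          MvPowerSeries.coeff c.1 (G : MvPowerSeries ℕ R) *
          MvPowerSeries.coeff c.2 (G' : MvPowerSeries ℕ R) := by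
      intro p hp
      have h2 := HasAntidiagonal.mem_antidiagonal.1 hp
      rw [coeff_ps G (d := d + d') (k := k) (fun m hm => hd m (by omega)) (by omega),
        coeff_ps G' (d := d + d') (k := k) (fun m hm => hd' m (by omega)) (by omega),
        sum_mul_sum, ← sum_product']
      refine sum_congr ?_ fun _ _ => rfl
      ext ⟨a, b⟩
      simp only [mem_product, mem_filter, Prod.ext_iff]
      tauto
    rw [sum_congr rfl h1]
    simp only [hmul]
    rw [sum_sigma', sum_sigma']
    refine sum_bij_ne_zero (fun x _ _ => ⟨(wt x.2.1, wt x.2.2), x.2⟩) ?_ ?_ ?_ ?_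
    · rintro ⟨m, a, b⟩ hx hne
      simp only [mem_sigma, mem_filter, HasAntidiagonal.mem_antidiagonal, mem_product] at hx hne ⊢
      obtain ⟨⟨_, h3⟩, rfl⟩ := hx
      rw [wt_add] at h3
      have ha : a.degree ≤ d := not_lt.1 fun hc => hne (by rw [hd a hc, zero_mul])
      have hb : b.degree ≤ d' := not_lt.1 fun hc => hne (by rw [hd' b hc, mul_zero])
      exact ⟨h3, ⟨mem_expBox (by omega) (by omega), mem_expBox (by omega) (by omega)⟩, trivial⟩
    · rintro ⟨m, a, b⟩ hx _ ⟨m', a', b'⟩ hx' _ h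
      simp only [mem_sigma, mem_filter, HasAntidiagonal.mem_antidiagonal] at hx hx'
      simp only [Sigma.mk.injEq, heq_eq_eq, Prod.mk.injEq] at h
      obtain ⟨-, rfl, rfl⟩ := h
      rw [← hx.2, ← hx'.2]
    · rintro ⟨p, a, b⟩ hx hne
      simp only [mem_sigma, mem_filter, HasAntidiagonal.mem_antidiagonal, mem_product] at hx hne
      obtain ⟨h3, -, rfl⟩ := hx
      have ha : a.degree ≤ d := not_lt.1 fun hc => hne (by rw [hd a hc, zero_mul])
      have hb : b.degree ≤ d' := not_lt.1 fun hc => hne (by rw [hd' b hc, mul_zero])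
      have h4 : wt (a + b) = k := by rw [wt_add]; exact h3
      refine ⟨⟨a + b, a, b⟩, ?_, hne, rfl⟩
      simp only [mem_sigma, mem_filter, HasAntidiagonal.mem_antidiagonal]
      exact ⟨⟨mem_expBox (by rw [map_add]; omega) h4.le, h4⟩, trivial⟩
    · intros; rfl
  · intro m hm
    rw [hmul]
    refine sum_eq_zero fun p hp => ?_
    have h : p.1.degree + p.2.degree = m.degree := by
      rw [← HasAntidiagonal.mem_antidiagonal.1 hp, map_add]
    rcases lt_or_ge d p.1.degree with h1 | h1
    · rw [hd _ h1, zero_mul]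
    · rw [hd' _ (by omega), mul_zero]

theorem finite_degree_wt (n k : ℕ) : {m : ℕ →₀ ℕ | m.degree = n ∧ wt m = k}.Finite :=
  (Finset.finite_toSet (expBox n k)).subset fun _ hm => mem_expBox hm.1.le hm.2.le

theorem coeff_h (n : ℕ) (m : ℕ →₀ ℕ) :
    MvPowerSeries.coeff m (h R n : MvPowerSeries ℕ R) = if m.degree = n then 1 else 0 := rfl

theorem coeff_ps_h (n k : ℕ) : PowerSeries.coeff k (ps R (h R n)) =
    (({m : ℕ →₀ ℕ | m.degree = n ∧ wt m = k}.ncard : ℕ) : R) := by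
  classical
  rw [coeff_ps (h R n) (d := n) (fun m hm => by rw [coeff_h, if_neg (by omega)]) le_rfl]
  simp only [coeff_h]
  rw [sum_boole, filter_filter, ← Set.ncard_coe_finset]
  congr 2
  ext m
  simp only [coe_filter, Set.mem_ofPred_eq]
  exact ⟨fun h => ⟨h.2.2, h.2.1⟩, fun h => ⟨mem_expBox h.1.le h.2.le, h.2, h.1⟩⟩

theorem degree_mapDomain_succ (m : ℕ →₀ ℕ) : (Finsupp.mapDomain Nat.succ m).degree = m.degree := by
  change (Finsupp.mapDomain Nat.succ m).sum (fun _ a => a) = m.sum fun _ a => a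
  exact Finsupp.sum_mapDomain_index (fun _ => rfl) fun _ _ _ => rfl

theorem wt_mapDomain_succ (m : ℕ →₀ ℕ) :
    wt (Finsupp.mapDomain Nat.succ m) = wt m + m.degree := by
  rw [wt, Finsupp.sum_mapDomain_index (fun _ => zero_mul _) fun _ _ _ => add_mul _ _ _, wt,
    Finsupp.degree_apply, Finsupp.sum, Finsupp.sum, ← sum_add_distrib]
  exact sum_congr rfl fun i _ => Nat.mul_succ _ _

/-- A monomial of degree `n + 1` either contains `x_0`, which has weight `0` and can be removed, or
is the shift `x_i ↦ x_(i+1)` of another monomial, which raises the weight by the degree. -/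
theorem ncard_degree_wt_succ (n k : ℕ) :
    {m : ℕ →₀ ℕ | m.degree = n + 1 ∧ wt m = k}.ncard =
      {m : ℕ →₀ ℕ | m.degree = n ∧ wt m = k}.ncard +
        {m : ℕ →₀ ℕ | m.degree = n + 1 ∧ wt m + (n + 1) = k}.ncard := by
  have h1 : {m : ℕ →₀ ℕ | m.degree = n + 1 ∧ wt m = k} =
      (fun m => m + Finsupp.single 0 1) '' {m : ℕ →₀ ℕ | m.degree = n ∧ wt m = k} ∪
      Finsupp.mapDomain Nat.succ '' {m : ℕ →₀ ℕ | m.degree = n + 1 ∧ wt m + (n + 1) = k} := by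
    ext m
    simp only [Set.mem_union, Set.mem_image, Set.mem_ofPred_eq]
    have hw : wt (Finsupp.single 0 1) = 0 := by simp [wt]
    constructor
    · rintro ⟨h1, h2⟩
      by_cases h0 : m 0 = 0
      · right
        have h3 : Finsupp.mapDomain Nat.succ (Finsupp.comapDomain Nat.succ m
            Nat.succ_injective.injOn) = m := by
          refine Finsupp.mapDomain_comapDomain _ Nat.succ_injective _ fun i hi => ?_
          rcases i with _ | i
          · exact absurd h0 (Finsupp.mem_support_iff.1 hi)
          · exact ⟨i, rfl⟩
        refine ⟨_, ?_, h3⟩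
        rw [← h3, degree_mapDomain_succ] at h1
        rw [← h3, wt_mapDomain_succ] at h2
        omega
      · left
        have h3 : m - Finsupp.single 0 1 + Finsupp.single 0 1 = m := by
          refine tsub_add_cancel_of_le ?_
          rw [Finsupp.single_le_iff]
          omega
        refine ⟨_, ?_, h3⟩
        rw [← h3, map_add, Finsupp.degree_single] at h1
        rw [← h3, wt_add, hw] at h2
        omega
    · rintro (⟨m, ⟨h1, h2⟩, rfl⟩ | ⟨m, ⟨h1, h2⟩, rfl⟩)
      · rw [map_add, Finsupp.degree_single, wt_add, hw]
        omega
      · rw [degree_mapDomain_succ, wt_mapDomain_succ]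
        omega
  have hfin : {m : ℕ →₀ ℕ | m.degree = n + 1 ∧ wt m + (n + 1) = k}.Finite :=
    (finite_degree_wt (n + 1) (k - (n + 1))).subset fun m hm => ⟨hm.1, by have := hm.2; omega⟩
  rw [h1, Set.ncard_union_eq _ ((finite_degree_wt n k).image _) (hfin.image _),
    Set.ncard_image_of_injective _ (add_left_injective _),
    Set.ncard_image_of_injective _ (Finsupp.mapDomain_injective Nat.succ_injective)]
  rw [Set.disjoint_left]
  rintro _ ⟨m, -, rfl⟩ ⟨m', -, h2⟩
  have h3 := DFunLike.congr_fun h2 0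
  rw [Finsupp.mapDomain_of_notMem_range _ _ (by simp)] at h3
  simp at h3

theorem ps_h_zero : ps R (h R 0) = 1 := by
  ext k
  rw [coeff_ps_h, PowerSeries.coeff_one]
  have h1 : {m : ℕ →₀ ℕ | m.degree = 0 ∧ wt m = k} = if k = 0 then {0} else ∅ := by
    ext m
    simp only [Set.mem_ofPred_eq, Finsupp.degree_eq_zero_iff]
    have hw : wt 0 = 0 := by simp [wt]
    split_ifs with hk
    · simp only [Set.mem_singleton_iff]
      exact ⟨fun h => h.1, fun h => ⟨h, by rw [h, hw, hk]⟩⟩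
    · simp only [Set.mem_empty_iff_false, iff_false]
      rintro ⟨rfl, h2⟩
      exact hk (by rw [← h2, hw])
  rw [h1]
  split_ifs <;> simp

theorem ps_h_succ (n : ℕ) :
    ps R (h R (n + 1)) = ps R (h R n) + PowerSeries.X ^ (n + 1) * ps R (h R (n + 1)) := by
  ext k
  rw [map_add, PowerSeries.coeff_X_pow_mul', coeff_ps_h, coeff_ps_h, coeff_ps_h,
    ncard_degree_wt_succ, Nat.cast_add]
  congr 1
  split_ifs with hk
  · congr 2
    ext m
    simp only [Set.mem_ofPred_eq]
    exact and_congr_right fun _ => by omega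
  · have : {m : ℕ →₀ ℕ | m.degree = n + 1 ∧ wt m + (n + 1) = k} = ∅ := by
      ext m
      simp only [Set.mem_ofPred_eq, Set.mem_empty_iff_false, iff_false]
      omega
    rw [this]
    simp

theorem qPochhammer_succ (n : ℕ) :
    qPochhammer R (n + 1) = qPochhammer R n * (1 - PowerSeries.X ^ (n + 1)) := by
  rw [qPochhammer, prod_Icc_succ_top (by omega)]
  rfl

theorem ps_h (n : ℕ) : ps R (h R n) = qPochhammerInv R n := by
  have h1 : qPochhammer R n * ps R (h R n) = 1 := by
    induction n with
    | zero => rw [ps_h_zero]; simp [qPochhammer]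
    | succ n ih =>
      rw [qPochhammer_succ]
      linear_combination ih + qPochhammer R n * ps_h_succ (R := R) n
  linear_combination qPochhammerInv R n * h1 - ps R (h R n) * qPochhammer_mul_inv R n

theorem h_zero : h R 0 = 1 := by
  classical
  refine Subtype.ext ?_
  ext m
  rw [coeff_h, OneMemClass.coe_one, MvPowerSeries.coeff_one]
  simp [Finsupp.degree_eq_zero_iff]

variable (R) in
/-- The stable principal specialization as a ring homomorphism. -/
def psHom : SymFun R →+* PowerSeries R :=
  RingHom.mk' ⟨⟨ps R, by rw [← h_zero, ps_h_zero]⟩, ps_mul⟩ ps_add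

theorem psPoly_eq_map (P : Polynomial (SymFun R)) :
    psPoly R P = P.map (psHom R) := by
  rw [psPoly, Polynomial.map, Polynomial.eval₂_def]
  refine sum_congr rfl fun i _ => ?_
  simp only [RingHom.comp_apply, Polynomial.C_mul_X_pow_eq_monomial]
  rfl

end PrincipalSpecialization

end EulerianSym

end
noncomputable section

namespace EulerianSym

/-! ### A MacMahon-type determinant formula -/

section MacMahon

open Finset

/-! ### Lagrange-type summation in one variable -/

section OneVariable

open Polynomial

variable {K : Type*} [CommRing K]

/-- The functional `f ↦ ∑_{b<N} x^b [Y^b] f (dY + l)^b`. -/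
def lagrangeSum (N : ℕ) (x d l : K) (f : K[X]) : K :=
  ∑ b ∈ range N, x ^ b * (f * (C d * X + C l) ^ b).coeff b

theorem lagrangeSum_add (N : ℕ) (x d l : K) (f g : K[X]) :
    lagrangeSum N x d l (f + g) = lagrangeSum N x d l f + lagrangeSum N x d l g := by
  simp only [lagrangeSum, add_mul, coeff_add, mul_add, sum_add_distrib]

theorem lagrangeSum_C_mul (N : ℕ) (x d l k : K) (f : K[X]) :
    lagrangeSum N x d l (C k * f) = k * lagrangeSum N x d l f := by
  rw [lagrangeSum, lagrangeSum, mul_sum]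
  refine sum_congr rfl fun b _ => ?_
  rw [mul_assoc, coeff_C_mul, mul_left_comm]

theorem sum_pow_mul_coeff_X_mul {N : ℕ} {x : K} (hx : x ^ N = 0) (g : ℕ → K[X]) :
    ∑ b ∈ range N, x ^ b * (X * g b).coeff b =
      x * ∑ b ∈ range N, x ^ b * (g (b + 1)).coeff b := by
  rcases N with _ | N
  · simp
  rw [sum_range_succ', sum_range_succ, mul_add, mul_sum, ← mul_assoc x (x ^ N), ← pow_succ', hx]
  simp [coeff_X_mul, pow_succ', mul_assoc]

/-- With `w = dY + l` and `L` the functional, cancelling one `Y` leaves one spare factor `w`, so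
`L(Yf) = x L(wf) = x (d L(Yf) + l L(f))`. Nilpotency of `x` disposes of the boundary term. -/
theorem lagrangeSum_X_mul {N : ℕ} {x : K} (hx : x ^ N = 0) (d l : K) (f : K[X]) :
    (1 - d * x) * lagrangeSum N x d l (X * f) = x * l * lagrangeSum N x d l f := by
  have h1 : lagrangeSum N x d l (X * f) =
      x * lagrangeSum N x d l (C d * (X * f) + C l * f) := by
    simp only [lagrangeSum]
    simp only [mul_assoc X f]
    rw [sum_pow_mul_coeff_X_mul hx fun b => f * (C d * X + C l) ^ b]
    congr 1
    refine sum_congr rfl fun b _ => ?_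
    congr 2
    ring
  rw [lagrangeSum_add, lagrangeSum_C_mul, lagrangeSum_C_mul] at h1
  linear_combination h1

theorem lagrangeSum_one {N : ℕ} {x : K} (hx : x ^ N = 0) (d l : K) :
    (1 - d * x) * lagrangeSum N x d l 1 = 1 := by
  have h1 : ∀ b, ((C d * X + C l) ^ b).coeff b = d ^ b := by
    intro b
    have := coeff_pow_of_natDegree_le (p := C d * X + C l) (n := 1) (m := b)
      natDegree_linear_le
    simpa using this
  simp only [lagrangeSum, one_mul, h1, ← mul_pow, mul_comm x d]
  rw [mul_neg_geom_sum, mul_pow, hx, mul_zero, sub_zero]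

/-- By the recursion for multiplication by `Y`, the functional is, up to the factor `v`, evaluation
at the solution `Y = v x l` of `Y = x (dY + l)`. -/
theorem lagrangeSum_eq {N : ℕ} {x : K} (hx : x ^ N = 0) {d l v : K} (hv : (1 - d * x) * v = 1)
    (f : K[X]) : lagrangeSum N x d l f = v * f.eval (v * x * l) := by
  have key : ∀ n, lagrangeSum N x d l (X ^ n) = v * (v * x * l) ^ n := by
    intro n
    induction n with
    | zero => rw [pow_zero]; linear_combination v * lagrangeSum_one hx d l -
        lagrangeSum N x d l 1 * hv
    | succ n ih =>
      rw [pow_succ']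
      have := lagrangeSum_X_mul hx d l (X ^ n)
      rw [ih] at this
      linear_combination v * this - lagrangeSum N x d l (X * X ^ n) * hv
  induction f using Polynomial.induction_on' with
  | add f g hf hg => rw [lagrangeSum_add, hf, hg, eval_add, mul_add]
  | monomial n a =>
    rw [← C_mul_X_pow_eq_monomial, lagrangeSum_C_mul, key, eval_mul, eval_C, eval_pow, eval_X]
    ring

/-- `w^b`, with the first factor (if any) replaced by `w - e`. -/
def modifiedPow {S : Type*} [CommRing S] (w e : S) : ℕ → S
  | 0 => 1
  | b + 1 => (w - e) * w ^ b

theorem map_modifiedPow {S T F : Type*} [CommRing S] [CommRing T] [FunLike F S T]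
    [RingHomClass F S T] (g : F) (w e : S) (b : ℕ) :
    g (modifiedPow w e b) = modifiedPow (g w) (g e) b := by
  cases b <;> simp [modifiedPow]

theorem sum_coeff_mul_modifiedPow {N : ℕ} {x : K} (hx : x ^ N = 0) {d l v : K}
    (hv : (1 - d * x) * v = 1) (τ : K) (f : K[X]) :
    ∑ b ∈ range N, x ^ b * (f * modifiedPow (C d * X + C l) (C τ * X) b).coeff b =
      (1 - τ * x) * v * f.eval (v * x * l) := by
  rcases N with _ | N
  -- For `N = 0` the hypothesis `x ^ 0 = 0` says that the ring is trivial.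
  · have : Subsingleton K := subsingleton_of_zero_eq_one (by simpa using hx.symm)
    exact Subsingleton.elim _ _
  have h1 : ∑ b ∈ range (N + 1), x ^ b * (f * modifiedPow (C d * X + C l) (C τ * X) b).coeff b =
      lagrangeSum (N + 1) x d l f - τ * (x * lagrangeSum (N + 1) x d l f) := by
    have h2 := sum_pow_mul_coeff_X_mul hx fun b => f * (C d * X + C l) ^ (b - 1)
    simp only [Nat.add_sub_cancel] at h2
    rw [lagrangeSum, ← h2, sum_range_succ', sum_range_succ' (n := N), sum_range_succ' (n := N)]
    simp only [modifiedPow, mul_add, mul_sum]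
    simp only [pow_zero, mul_coeff_zero, coeff_X_zero, zero_mul, mul_zero, add_zero, mul_one,
      one_mul]
    refine Eq.trans ?_ (add_sub_right_comm _ _ _).symm
    rw [← sum_sub_distrib]
    congr 1
    refine sum_congr rfl fun b _ => ?_
    rw [show f * ((C d * X + C l - C τ * X) * (C d * X + C l) ^ b) =
      f * (C d * X + C l) ^ (b + 1) - C τ * (X * (f * (C d * X + C l) ^ b)) by ring,
      coeff_sub, coeff_C_mul]
    simp only [Nat.add_sub_cancel]
    ring
  rw [h1, lagrangeSum_eq hx hv]
  ring

end OneVariable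

/-! ### Diagonal coefficients of products of linear forms -/

variable {A : Type*} [CommRing A]

/-- The linear form `p ∑_{i<k} y_i + d y_k + u ∑_{i>k} y_i`. -/
def weightForm {m : ℕ} (p d u : A) (k : Fin m) : MvPolynomial (Fin m) A :=
  ∑ i, MvPolynomial.C (if i < k then p else if i = k then d else u) * MvPolynomial.X i

/-- The product over the blocks `k` of the powers `a_k` of the forms, the first factor of each
being diminished by `τ y_k`. -/
def blockProd {m : ℕ} (p d u τ : A) (a : Fin m → ℕ) : MvPolynomial (Fin m) A :=
  ∏ k, modifiedPow (weightForm p d u k) (MvPolynomial.C τ * MvPolynomial.X k) (a k)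

/-- The diagonal coefficient of `blockProd`. -/
def blockCoeff {m : ℕ} (p d u τ : A) (a : Fin m → ℕ) : A :=
  MvPolynomial.coeff (Finsupp.equivFunOnFinite.symm a) (blockProd p d u τ a)

theorem map_blockCoeff {B : Type*} [CommRing B] (g : A →+* B) {m : ℕ} (p d u τ : A)
    (a : Fin m → ℕ) : g (blockCoeff p d u τ a) = blockCoeff (g p) (g d) (g u) (g τ) a := by
  rw [blockCoeff, ← MvPolynomial.coeff_map, blockCoeff, blockProd, map_prod]
  congr 1
  refine prod_congr rfl fun k _ => ?_
  rw [map_modifiedPow, weightForm, map_sum, map_mul, MvPolynomial.map_C, MvPolynomial.map_X]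
  congr 1
  refine sum_congr rfl fun i _ => ?_
  rw [map_mul, MvPolynomial.map_C, MvPolynomial.map_X]
  split_ifs <;> rfl

theorem sum_piFinset_cons {M : Type*} [AddCommMonoid M] (m : ℕ) (s : Finset ℕ)
    (F : (Fin (m + 1) → ℕ) → M) :
    ∑ a ∈ Fintype.piFinset fun _ => s, F a =
      ∑ a ∈ Fintype.piFinset fun _ : Fin m => s, ∑ b ∈ s, F (Fin.cons b a) := by
  rw [sum_comm, ← sum_product']
  refine sum_nbij' (fun a => (a 0, Fin.tail a)) (fun c => Fin.cons c.1 c.2) ?_ ?_ ?_ ?_ ?_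
  · intro a ha
    rw [Fintype.mem_piFinset] at ha
    simp only [mem_product, Fintype.mem_piFinset]
    exact ⟨ha 0, fun i => ha i.succ⟩
  · rintro ⟨b, a⟩ hc
    simp only [mem_product, Fintype.mem_piFinset] at hc ⊢
    intro i
    refine Fin.cases ?_ (fun i => ?_) i
    · exact hc.1
    · exact hc.2 i
  · intro a _; simp
  · rintro ⟨b, a⟩ _; simp
  · intro a _; simp

theorem finSuccEquiv_weightForm_zero {m : ℕ} (p d u : A) :
    MvPolynomial.finSuccEquiv A m (weightForm p d u 0) =
      Polynomial.C (MvPolynomial.C d) * Polynomial.X +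
        Polynomial.C (MvPolynomial.C u * ∑ i, MvPolynomial.X i) := by
  rw [weightForm, Fin.sum_univ_succ, map_add, map_sum, map_mul, MvPolynomial.finSuccEquiv_X_zero]
  have hC : ∀ r : A, MvPolynomial.finSuccEquiv A m (MvPolynomial.C r) =
    Polynomial.C (MvPolynomial.C r) := fun r => by simp [MvPolynomial.finSuccEquiv_apply]
  simp [hC, mul_sum, MvPolynomial.finSuccEquiv_X_succ]

theorem finSuccEquiv_weightForm_succ {m : ℕ} (p d u : A) (k : Fin m) :
    MvPolynomial.finSuccEquiv A m (weightForm p d u k.succ) =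
      Polynomial.C (weightForm p d u k) + Polynomial.C (MvPolynomial.C p) * Polynomial.X := by
  rw [weightForm, Fin.sum_univ_succ, map_add, map_sum, map_mul, MvPolynomial.finSuccEquiv_X_zero]
  have hC : ∀ r : A, MvPolynomial.finSuccEquiv A m (MvPolynomial.C r) =
    Polynomial.C (MvPolynomial.C r) := fun r => by simp [MvPolynomial.finSuccEquiv_apply]
  simp [hC, weightForm, MvPolynomial.finSuccEquiv_X_succ, add_comm]

theorem weightForm_add {m : ℕ} (p d u c : A) (k : Fin m) :
    weightForm (p + c) (d + c) (u + c) k =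
      weightForm p d u k + MvPolynomial.C c * ∑ i, MvPolynomial.X i := by
  rw [weightForm, weightForm, mul_sum, ← sum_add_distrib]
  refine sum_congr rfl fun i _ => ?_
  rw [← add_mul, ← MvPolynomial.C_add]
  split_ifs <;> rfl

theorem sum_pow_mul_coeff {m N : ℕ} (x : A) (e : Fin m →₀ ℕ) (g : ℕ → MvPolynomial (Fin m) A) :
    ∑ b ∈ range N, x ^ b * MvPolynomial.coeff e (g b) =
      MvPolynomial.coeff e (∑ b ∈ range N, MvPolynomial.C x ^ b * g b) := by
  rw [MvPolynomial.coeff_sum]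
  exact sum_congr rfl fun b _ => by rw [← map_pow, MvPolynomial.coeff_C_mul]

/-- The product of the blocks `k > 0`, as a polynomial in the first variable. -/
def tailProd {m : ℕ} (p d u τ : A) (a : Fin m → ℕ) : Polynomial (MvPolynomial (Fin m) A) :=
  ∏ k, modifiedPow
    (Polynomial.C (weightForm p d u k) + Polynomial.C (MvPolynomial.C p) * Polynomial.X)
    (Polynomial.C (MvPolynomial.C τ * MvPolynomial.X k)) (a k)

/-- In every later block the first variable occurs with the same coefficient `p`. Replacing it by a
multiple of `∑ y_i` therefore shifts the three parameters equally, and the family of products is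
preserved. -/
theorem eval_tailProd {m : ℕ} (p d u τ c : A) (a : Fin m → ℕ) :
    (tailProd p d u τ a).eval (MvPolynomial.C c * ∑ i, MvPolynomial.X i) =
      blockProd (p + c * p) (d + c * p) (u + c * p) τ a := by
  rw [tailProd, Polynomial.eval_prod, blockProd]
  refine prod_congr rfl fun k _ => ?_
  rw [← Polynomial.coe_evalRingHom, map_modifiedPow, weightForm_add]
  simp only [Polynomial.coe_evalRingHom, Polynomial.eval_add, Polynomial.eval_C,
    Polynomial.eval_mul, Polynomial.eval_X]
  congr 1
  rw [map_mul]
  ring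

theorem blockCoeff_cons {m : ℕ} (p d u τ : A) (b : ℕ) (a : Fin m → ℕ) :
    blockCoeff p d u τ (Fin.cons b a : Fin (m + 1) → ℕ) =
      MvPolynomial.coeff (Finsupp.equivFunOnFinite.symm a)
        ((tailProd p d u τ a * modifiedPow (Polynomial.C (MvPolynomial.C d) * Polynomial.X +
        Polynomial.C (MvPolynomial.C u * ∑ i, MvPolynomial.X i))
          (Polynomial.C (MvPolynomial.C τ) * Polynomial.X) b).coeff b) := by
  have hC : ∀ r : A, MvPolynomial.finSuccEquiv A m (MvPolynomial.C r) =
    Polynomial.C (MvPolynomial.C r) := fun r => by simp [MvPolynomial.finSuccEquiv_apply]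
  have e1 : Finsupp.equivFunOnFinite.symm (Fin.cons b a : Fin (m + 1) → ℕ) =
      Finsupp.cons b (Finsupp.equivFunOnFinite.symm a) := by
    ext i
    refine Fin.cases ?_ (fun i => ?_) i <;> simp
  rw [blockCoeff, e1, ← MvPolynomial.finSuccEquiv_coeff_coeff, blockProd, map_prod,
    Fin.prod_univ_succ, mul_comm, tailProd]
  simp only [map_modifiedPow, map_mul, hC, finSuccEquiv_weightForm_zero, finSuccEquiv_weightForm_succ,
    MvPolynomial.finSuccEquiv_X_zero, MvPolynomial.finSuccEquiv_X_succ, Fin.cons_zero,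
    Fin.cons_succ]

theorem sum_blockCoeff_cons {N : ℕ} {x : A} (hx : x ^ N = 0) {p d u v : A}
    (hv : (1 - d * x) * v = 1) (τ : A) {m : ℕ} (a : Fin m → ℕ) :
    ∑ b ∈ range N, x ^ b * blockCoeff p d u τ (Fin.cons b a : Fin (m + 1) → ℕ) =
      (1 - τ * x) * v *
        blockCoeff (p + v * x * u * p) (d + v * x * u * p) (u + v * x * u * p) τ a := by
  simp only [blockCoeff_cons]
  have hx' : (MvPolynomial.C x : MvPolynomial (Fin m) A) ^ N = 0 := by
    rw [← map_pow, hx, map_zero]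
  have hv' : (1 - MvPolynomial.C d * MvPolynomial.C x) * MvPolynomial.C v =
      (1 : MvPolynomial (Fin m) A) := by
    rw [← map_one MvPolynomial.C, ← map_mul, ← map_sub, ← map_mul, hv]
  rw [sum_pow_mul_coeff, sum_coeff_mul_modifiedPow hx' hv', ← mul_assoc (_ * _) (MvPolynomial.C u),
    ← map_mul, ← map_mul, ← map_mul, eval_tailProd, ← map_one MvPolynomial.C, ← map_sub, ← map_mul,
    MvPolynomial.coeff_C_mul, blockCoeff]

/-- Eliminating the first variable shifts `p`, `d`, `u` by the common amount `v x₀ u p`. The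
differences `d - p`, `d - u`, `u - p` survive, so the induction hypothesis involves the same
products over the remaining variables. -/
theorem sum_blockCoeff_mul {N m : ℕ} (x : Fin m → A) (hx : ∀ k, x k ^ N = 0) (p d u τ : A) :
    (∑ a ∈ Fintype.piFinset fun _ => range N, (∏ k, x k ^ a k) * blockCoeff p d u τ a) *
      (u * ∏ k, (1 - (d - p) * x k) - p * ∏ k, (1 - (d - u) * x k)) =
      (u - p) * ∏ k, (1 - τ * x k) := by
  induction m generalizing p d u with
  | zero =>
    have h1 : ∀ a : Fin 0 → ℕ, blockCoeff p d u τ a = 1 := fun a => by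
      rw [blockCoeff, Subsingleton.elim (Finsupp.equivFunOnFinite.symm a) 0]
      simp [blockProd]
    simp [h1]
  | succ m ih =>
    obtain ⟨w, hw⟩ := IsNilpotent.isUnit_one_sub (r := d * x 0)
      ⟨N, by rw [mul_pow, hx 0, mul_zero]⟩
    have hv : (1 - d * x 0) * (↑w⁻¹ : A) = 1 := by rw [← hw]; exact w.mul_inv
    set v : A := ↑w⁻¹
    have h1 := ih (fun k => x k.succ) (fun k => hx k.succ) (p + v * x 0 * u * p)
      (d + v * x 0 * u * p) (u + v * x 0 * u * p)
    simp only [add_sub_add_right_eq_sub] at h1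
    rw [sum_piFinset_cons]
    simp only [Fin.prod_univ_succ, Fin.cons_zero, Fin.cons_succ]
    have h2 : ∀ a : Fin m → ℕ, ∑ b ∈ range N, (x 0 ^ b * ∏ k, x k.succ ^ a k) *
        blockCoeff p d u τ (Fin.cons b a : Fin (m + 1) → ℕ) =
        (1 - τ * x 0) * v * ((∏ k, x k.succ ^ a k) *
          blockCoeff (p + v * x 0 * u * p) (d + v * x 0 * u * p) (u + v * x 0 * u * p) τ a) := by
      intro a
      rw [mul_left_comm, ← sum_blockCoeff_cons (hx 0) hv, mul_sum]
      exact sum_congr rfl fun b _ => by ring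
    simp only [h2, ← mul_sum]
    set G := ∑ a ∈ Fintype.piFinset fun _ : Fin m => range N, (∏ k, x k.succ ^ a k) *
      blockCoeff (p + v * x 0 * u * p) (d + v * x 0 * u * p) (u + v * x 0 * u * p) τ a
    set P := ∏ k : Fin m, (1 - (d - p) * x k.succ)
    set P' := ∏ k : Fin m, (1 - (d - u) * x k.succ)
    -- The new first factors of the two products in the denominator are exactly what turns the
    -- shifted `u` and `p` back into the original ones.
    have h3 : u * (1 - (d - p) * x 0) = (u + v * x 0 * u * p) * (1 - d * x 0) := by
      linear_combination - x 0 * u * p * hv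
    have h4 : p * (1 - (d - u) * x 0) = (p + v * x 0 * u * p) * (1 - d * x 0) := by
      linear_combination - x 0 * u * p * hv
    linear_combination (1 - τ * x 0) * v * G * (P * h3 - P' * h4) +
      (1 - τ * x 0) * v * (1 - d * x 0) * h1 +
      (u - p) * (1 - τ * x 0) * (∏ k : Fin m, (1 - τ * x k.succ)) * hv

end MacMahon

end EulerianSym

end
noncomputable section

namespace EulerianSym

/-! ### Permutations with compatible sequences as words -/

section Words

open Finset

/-- The descent set of `σ` for the order in which every value at an excedance precedes every
value at a non-excedance. -/
def dexSet {n : ℕ} (σ : Equiv.Perm (Fin n)) : Finset (Fin n) :=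
  {i : Fin n | ∃ h : (i : ℕ) + 1 < n, (¬ i < σ i ∧ (⟨i + 1, h⟩ : Fin n) < σ ⟨i + 1, h⟩) ∨
    ((i < σ i ↔ (⟨i + 1, h⟩ : Fin n) < σ ⟨i + 1, h⟩) ∧ σ ⟨i + 1, h⟩ < σ i)}

/-- The sequence `s` is weakly increasing, and strictly so at the positions in `D`. -/
def Compat {m n : ℕ} (D : Finset (Fin n)) (s : Fin n → Fin m) : Prop :=
  ∀ (i : Fin n) (h : (i : ℕ) + 1 < n), (s i : ℕ) + (if i ∈ D then 1 else 0) ≤ s ⟨i + 1, h⟩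

instance {m n : ℕ} (D : Finset (Fin n)) : DecidablePred (Compat (m := m) D) :=
  fun _ => Classical.propDecidable _

theorem strictMono_iff_lt_next {α : Type*} [Preorder α] {n : ℕ} (f : Fin n → α) :
    StrictMono f ↔ ∀ (i : Fin n) (h : (i : ℕ) + 1 < n), f i < f ⟨i + 1, h⟩ := by
  refine ⟨fun hf i h => hf (by simp [Fin.lt_def]), fun hf => ?_⟩
  rcases n with _ | n
  · exact fun i => i.elim0
  rw [Fin.strictMono_iff_lt_succ]
  intro i
  have := hf i.castSucc (by simp)
  exact this

/-- The pair formed by the value of `s` and the truth value of `i` being a non-excedance. -/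
def keyAt {m n : ℕ} (σ : Equiv.Perm (Fin n)) (s : Fin n → Fin m) (i : Fin n) :
    Lex (Fin m × Bool) := toLex (s i, !decide (i < σ i))

theorem compat_dexSet_iff_strictMono {m n : ℕ} (σ : Equiv.Perm (Fin n)) (s : Fin n → Fin m) :
    Compat (dexSet σ) s ↔ StrictMono fun i => toLex (keyAt σ s i, σ i) := by
  rw [strictMono_iff_lt_next]
  refine forall₂_congr fun i h => ?_
  have hne : σ i ≠ σ ⟨i + 1, h⟩ := fun hc => by
    have := congrArg Fin.val (σ.injective hc)
    simp at this
  simp only [keyAt, Prod.Lex.toLex_lt_toLex, dexSet, mem_filter, mem_univ, true_and, h,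
    exists_true_left, EmbeddingLike.apply_eq_iff_eq, Prod.mk.injEq]
  have hne' : (σ i : ℕ) ≠ σ ⟨i + 1, h⟩ := fun hc => hne (Fin.ext hc)
  have hs : s i = s ⟨i + 1, h⟩ ↔ (s i : ℕ) = s ⟨i + 1, h⟩ := Fin.ext_iff
  rw [hs]
  by_cases h1 : i < σ i <;> by_cases h2 : (⟨i + 1, h⟩ : Fin n) < σ ⟨i + 1, h⟩ <;>
  by_cases h3 : σ ⟨i + 1, h⟩ < σ i <;>
  simp [h1, h2, h3] <;> simp only [Fin.lt_def, Fin.le_def, Fin.ext_iff] at * <;> omega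

/-- Compatibility means that the triples (value of `s`, non-excedance flag, `σ i`) increase strictly
in lexicographic order. This characterizes `σ` as the stable sort of the word with letter `keyAt σ s
i` at position `σ i`. -/
theorem compat_dexSet_iff_sort {m n : ℕ} (σ : Equiv.Perm (Fin n)) (s : Fin n → Fin m) :
    Compat (dexSet σ) s ↔ σ = Tuple.sort fun j => keyAt σ s (σ.symm j) := by
  rw [compat_dexSet_iff_strictMono, Tuple.eq_sort_iff]
  have h0 : (fun j => keyAt σ s (σ.symm j)) ∘ σ = keyAt σ s := by ext i : 1; simp
  rw [h0]
  simp only [Equiv.symm_apply_apply]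
  constructor
  · intro h
    refine ⟨fun i j hij => ?_, fun i j hij he => ?_⟩
    · rcases hij.eq_or_lt with rfl | hij
      · rfl
      · rcases Prod.Lex.toLex_lt_toLex.1 (h hij) with h | h
        · exact h.le
        · exact h.1.le
    · rcases Prod.Lex.toLex_lt_toLex.1 (h hij) with h | h
      · exact absurd he h.ne
      · exact h.2
  · rintro ⟨h1, h2⟩ i j hij
    refine Prod.Lex.toLex_lt_toLex.2 ?_
    rcases (h1 hij.le).eq_or_lt with h | h
    · exact Or.inr ⟨h, h2 i j hij h⟩
    · exact Or.inl h

/-- The number of letters of `v` that are smaller than `k`. -/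
def countBelow {m n : ℕ} (v : Fin n → Fin m) (k : Fin m) : ℕ := #{j | v j < k}

/-- The number of letters of `v` that are at most `k`. -/
def countUpTo {m n : ℕ} (v : Fin n → Fin m) (k : Fin m) : ℕ := #{j | v j ≤ k}

/-- The letters of value `k` fill the sorted positions from `countBelow k` to `countUpTo k - 1`,
those flagged `false` (excedances) first. Since `σ` increases along equal letters, `i < σ i` needs
checking only at the first `false` letter, and `σ i ≤ i` only at the last `true` letter, where `i`
is one end of that interval. -/
theorem excedance_iff_local {m n : ℕ} (c : Fin n → Lex (Fin m × Bool)) :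
    (∀ i, (ofLex (c (Tuple.sort c i))).2 = !decide (i < Tuple.sort c i)) ↔
    ∀ j : Fin n, if (ofLex (c j)).2 then
      (j : ℕ) < countUpTo (fun j => (ofLex (c j)).1) (ofLex (c j)).1 else
      countBelow (fun j => (ofLex (c j)).1) (ofLex (c j)).1 < j := by
  set σ := Tuple.sort c with hσ
  have hmono : Monotone (c ∘ σ) := Tuple.monotone_sort c
  have hlt : ∀ i j, i < j → c (σ i) = c (σ j) → σ i < σ j := (Tuple.eq_sort_iff.1 hσ).2
  have hs : ∀ i j, i ≤ j → (ofLex (c (σ i))).1 ≤ (ofLex (c (σ j))).1 := by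
    intro i j hij
    rcases Prod.Lex.le_iff.1 (hmono hij) with h | h
    · exact h.le
    · exact h.1.le
  have hB : ∀ k, countBelow (fun j => (ofLex (c j)).1) k = #{i | (ofLex (c (σ i))).1 < k} := by
    intro k
    refine (card_bij (fun i _ => σ i) ?_ ?_ ?_).symm
    · simp
    · intro a _ b _ h; exact σ.injective h
    · intro b hb; exact ⟨σ.symm b, by simpa using hb, by simp⟩
  have hU : ∀ k, countUpTo (fun j => (ofLex (c j)).1) k = #{i | (ofLex (c (σ i))).1 ≤ k} := by
    intro k
    refine (card_bij (fun i _ => σ i) ?_ ?_ ?_).symm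
    · simp
    · intro a _ b _ h; exact σ.injective h
    · intro b hb; exact ⟨σ.symm b, by simpa using hb, by simp⟩
  constructor
  · intro h j
    obtain ⟨i, rfl⟩ := σ.surjective j
    have h1 : #{i' | (ofLex (c (σ i'))).1 < (ofLex (c (σ i))).1} ≤ i := by
      rw [← Fin.card_Iio]
      refine card_le_card fun i' hi' => ?_
      simp only [mem_filter, mem_univ, true_and] at hi'
      rw [mem_Iio]
      by_contra hc
      exact absurd hi' (not_lt.2 (hs _ _ (not_lt.1 hc)))
    have h2 : (i : ℕ) + 1 ≤ #{i' | (ofLex (c (σ i'))).1 ≤ (ofLex (c (σ i))).1} := by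
      rw [← Fin.card_Iic]
      refine card_le_card fun i' hi' => ?_
      simp only [mem_filter, mem_univ, true_and]
      exact hs _ _ (mem_Iic.1 hi')
    rw [hB, hU]
    have h3 := h i
    split_ifs with h4
    · rw [h4] at h3
      have : ¬ i < σ i := by simpa using h3
      rw [Fin.lt_def] at this
      omega
    · have : i < σ i := by simpa [h4] using h3
      rw [Fin.lt_def] at this
      omega
  · intro h
    -- Upward induction: a strict excess of `σ i` over `i` propagates along a run of equal letters.
    -- At the start of a run of `false` letters all earlier sorted letters have smaller value, so `i
    -- ≤ countBelow`.
    have hF : ∀ r : ℕ, ∀ i : Fin n, (i : ℕ) = r → (ofLex (c (σ i))).2 = false → i < σ i := by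
      intro r
      induction r with
      | zero =>
        intro i hi hb
        have := h (σ i)
        rw [hb] at this
        rw [Fin.lt_def]
        simp at this
        omega
      | succ r ih =>
        intro i hi hb
        have hr : r < n := by omega
        by_cases he : c (σ ⟨r, hr⟩) = c (σ i)
        · have h1 := ih ⟨r, hr⟩ rfl (by rw [he, hb])
          have h2 := hlt ⟨r, hr⟩ i (by rw [Fin.lt_def]; simp; omega) he
          rw [Fin.lt_def] at h1 h2 ⊢
          simp at h1
          omega
        · have h1 : c (σ ⟨r, hr⟩) < c (σ i) :=
            lt_of_le_of_ne (hmono (by rw [Fin.le_def]; simp; omega)) he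
          have h2 : (ofLex (c (σ ⟨r, hr⟩))).1 < (ofLex (c (σ i))).1 := by
            rcases Prod.Lex.lt_iff.1 h1 with h | h
            · exact h
            · rw [hb] at h
              exact absurd h.2 (by simp)
          have h3 := h (σ i)
          rw [hb, hB] at h3
          have h4 : (i : ℕ) ≤ #{i' | (ofLex (c (σ i'))).1 < (ofLex (c (σ i))).1} := by
            rw [← Fin.card_Iio]
            refine card_le_card fun i' hi' => ?_
            simp only [mem_filter, mem_univ, true_and]
            rw [mem_Iio, Fin.lt_def] at hi'
            exact (hs i' ⟨r, hr⟩ (by rw [Fin.le_def]; simp; omega)).trans_lt h2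
          simp only [Bool.false_eq_true, if_false] at h3
          rw [Fin.lt_def]
          omega
    -- Dually, downward induction from the last position, using `countUpTo ≤ i + 1` at the end of a
    -- run of `true` letters.
    have hT : ∀ r : ℕ, ∀ i : Fin n, (i : ℕ) + 1 + r = n → (ofLex (c (σ i))).2 = true →
        σ i ≤ i := by
      intro r
      induction r with
      | zero =>
        intro i hi hb
        rw [Fin.le_def]
        have := (σ i).isLt
        omega
      | succ r ih =>
        intro i hi hb
        have hr : (i : ℕ) + 1 < n := by omega
        by_cases he : c (σ i) = c (σ ⟨i + 1, hr⟩)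
        · have h1 := ih ⟨i + 1, hr⟩ (by simp; omega) (by rw [← he, hb])
          have h2 := hlt i ⟨i + 1, hr⟩ (by rw [Fin.lt_def]; simp) he
          rw [Fin.lt_def] at h2
          rw [Fin.le_def] at h1 ⊢
          simp at h1
          omega
        · have h1 : c (σ i) < c (σ ⟨i + 1, hr⟩) :=
            lt_of_le_of_ne (hmono (by rw [Fin.le_def]; simp)) he
          have h2 : (ofLex (c (σ i))).1 < (ofLex (c (σ ⟨i + 1, hr⟩))).1 := by
            rcases Prod.Lex.lt_iff.1 h1 with h | h
            · exact h
            · rw [hb] at h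
              exact absurd h.2 (by simp)
          have h3 := h (σ i)
          rw [hb, hU] at h3
          have h4 : #{i' | (ofLex (c (σ i'))).1 ≤ (ofLex (c (σ i))).1} ≤ (i : ℕ) + 1 := by
            rw [← Fin.card_Iic]
            refine card_le_card fun i' hi' => ?_
            simp only [mem_filter, mem_univ, true_and] at hi'
            rw [mem_Iic]
            by_contra hc
            rw [not_le, Fin.lt_def] at hc
            exact absurd (h2.trans_le (hs ⟨i + 1, hr⟩ i' (by rw [Fin.le_def]; simp; omega)))
              (not_lt.2 hi')
          simp only [if_true] at h3
          rw [Fin.le_def]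
          omega
    intro i
    cases hb : (ofLex (c (σ i))).2 with
    | false => simpa using hF i i rfl hb
    | true => simpa using hT (n - 1 - i) i (by omega) hb

variable {B : Type*} [CommRing B]

/-- The generating function of the permutations of `[n]` by excedances, and of the sequences
compatible with them. -/
def permSum {m : ℕ} (t : B) (ξ : Fin m → B) (n : ℕ) : B :=
  ∑ σ : Equiv.Perm (Fin n), t ^ exc σ * ∑ s : Fin n → Fin m with Compat (dexSet σ) s, ∏ i, ξ (s i)

/-- The sum of the `a_i` with `i < k`. -/
def sumBelow {m : ℕ} (a : Fin m → ℕ) (k : Fin m) : ℕ := ∑ i with i < k, a i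

/-- The sum of the `a_i` with `i ≤ k`. -/
def sumUpTo {m : ℕ} (a : Fin m → ℕ) (k : Fin m) : ℕ := ∑ i with i ≤ k, a i

/-- The weight of the letter `x` at position `j` of a word with content `a`. -/
def letterWeight {m : ℕ} (t : B) (a : Fin m → ℕ) (j : ℕ) (x : Lex (Fin m × Bool)) : B :=
  if (ofLex x).2 then if j < sumUpTo a (ofLex x).1 then 1 else 0
  else if sumBelow a (ofLex x).1 < j ∨ sumUpTo a (ofLex x).1 ≤ j then t else 0

theorem letterWeight_true {m : ℕ} (t : B) (a : Fin m → ℕ) (j : ℕ) (l : Fin m) :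
    letterWeight t a j (toLex (l, true)) = if j < sumUpTo a l then 1 else 0 := rfl

theorem letterWeight_false {m : ℕ} (t : B) (a : Fin m → ℕ) (j : ℕ) (l : Fin m) :
    letterWeight t a j (toLex (l, false)) =
      if sumBelow a l < j ∨ sumUpTo a l ≤ j then t else 0 := rfl

/-- The number of occurrences of each letter. -/
def content {m n : ℕ} (v : Fin n → Fin m) (k : Fin m) : ℕ := #{j | v j = k}

theorem countBelow_eq {m n : ℕ} (v : Fin n → Fin m) (k : Fin m) :
    countBelow v k = sumBelow (content v) k := by
  rw [countBelow, sumBelow, card_eq_sum_card_fiberwise (f := v) (t := {i | i < k})]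
  · refine sum_congr rfl fun i hi => ?_
    rw [content, filter_filter]
    congr 1
    ext j
    simp only [mem_filter, mem_univ, true_and] at hi ⊢
    exact ⟨fun h => h.2, fun h => ⟨h ▸ hi, h⟩⟩
  · intro j hj; simpa using hj

theorem countUpTo_eq {m n : ℕ} (v : Fin n → Fin m) (k : Fin m) :
    countUpTo v k = sumUpTo (content v) k := by
  rw [countUpTo, sumUpTo, card_eq_sum_card_fiberwise (f := v) (t := {i | i ≤ k})]
  · refine sum_congr rfl fun i hi => ?_
    rw [content, filter_filter]
    congr 1
    ext j
    simp only [mem_filter, mem_univ, true_and] at hi ⊢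
    exact ⟨fun h => h.2, fun h => ⟨h ▸ hi, h⟩⟩
  · intro j hj; simpa using hj

theorem countBelow_lt_countUpTo {m n : ℕ} (v : Fin n → Fin m) (j : Fin n) :
    countBelow v (v j) < countUpTo v (v j) := by
  refine card_lt_card (ssubset_iff_of_subset ?_ |>.2 ⟨j, by simp, by simp⟩)
  exact monotone_filter_right _ fun i _ h => le_of_lt h

theorem prod_letterWeight {m n : ℕ} (t : B) (c : Fin n → Lex (Fin m × Bool)) :
    ∏ j : Fin n, letterWeight t (content fun j => (ofLex (c j)).1) j (c j) =
      if ∀ i, (ofLex (c (Tuple.sort c i))).2 = !decide (i < Tuple.sort c i) then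
        ∏ j, (if (ofLex (c j)).2 then 1 else t) else 0 := by
  classical
  rw [if_congr (excedance_iff_local c) rfl rfl]
  simp only [countBelow_eq, countUpTo_eq]
  split_ifs with h
  · refine prod_congr rfl fun j _ => ?_
    have := h j
    rw [letterWeight]
    split_ifs at this ⊢ with h1 h2
    · rfl
    · rfl
    · exact absurd (Or.inl this) h2
  · push Not at h
    obtain ⟨j, hj⟩ := h
    refine prod_eq_zero (mem_univ j) ?_
    have h2 := countBelow_lt_countUpTo (fun j => (ofLex (c j)).1) j
    rw [countBelow_eq, countUpTo_eq] at h2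
    rw [letterWeight]
    split_ifs at hj ⊢ with h1 h3
    · rfl
    · exact absurd h3 (by omega)
    · rfl

theorem sum_content_weight {m : ℕ} (ξ : Fin m → B) {n : ℕ} (v : Fin n → Fin m) :
    ∏ j, ξ (v j) = ∏ k, ξ k ^ content v k := by
  rw [← prod_fiberwise_of_maps_to (s := univ) (t := univ) (g := v) fun _ _ => mem_univ _]
  refine prod_congr rfl fun k _ => ?_
  rw [content, prod_congr rfl (g := fun _ => ξ k), prod_const]
  intro j hj
  rw [(mem_filter.1 hj).2]

/-- The letter weights kill exactly the words whose flags disagree with the excedances of their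
stable sort. The other words correspond bijectively to the pairs `(σ, s)`. -/
theorem permSum_eq_sum_words {m : ℕ} (t : B) (ξ : Fin m → B) (n : ℕ) :
    permSum t ξ n = ∑ c : Fin n → Lex (Fin m × Bool),
      (∏ j : Fin n, letterWeight t (content fun j => (ofLex (c j)).1) j (c j)) *
        ∏ j, ξ (ofLex (c j)).1 := by
  classical
  simp only [prod_letterWeight, ite_mul, zero_mul]
  rw [← sum_filter, permSum]
  simp only [mul_sum]
  rw [sum_sigma' univ fun σ : Equiv.Perm (Fin n) => {s : Fin n → Fin m | Compat (dexSet σ) s}]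
  refine sum_bij' (fun p _ => fun j => keyAt p.1 p.2 (p.1.symm j))
    (fun c _ => ⟨Tuple.sort c, fun i => (ofLex (c (Tuple.sort c i))).1⟩) ?_ ?_ ?_ ?_ ?_
  · rintro ⟨σ, s⟩ hs
    simp only [mem_sigma, mem_univ, true_and, mem_filter] at hs ⊢
    rw [← (compat_dexSet_iff_sort σ s).1 hs]
    intro i
    simp [keyAt]
  · intro c hc
    simp only [mem_sigma, mem_univ, true_and, mem_filter] at hc ⊢
    rw [compat_dexSet_iff_sort]
    congr 1
    ext j : 1
    have := hc ((Tuple.sort c).symm j)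
    simp only [keyAt, Equiv.apply_symm_apply] at this ⊢
    rw [← this]
    rfl
  · rintro ⟨σ, s⟩ hs
    simp only [mem_sigma, mem_univ, true_and, mem_filter] at hs ⊢
    rw [← (compat_dexSet_iff_sort σ s).1 hs]
    simp [keyAt]
  · intro c hc
    simp only [mem_univ, true_and, mem_filter] at hc ⊢
    ext j : 1
    have := hc ((Tuple.sort c).symm j)
    simp only [keyAt, Equiv.apply_symm_apply] at this ⊢
    rw [← this]
    rfl
  · rintro ⟨σ, s⟩ hs
    simp only
    have h1 : ∏ j, (if (ofLex (keyAt σ s (σ.symm j))).2 then 1 else t) = t ^ exc σ := by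
      rw [← Equiv.prod_comp σ]
      simp only [Equiv.symm_apply_apply, keyAt, ofLex_toLex]
      rw [exc, excedances, ← prod_const, prod_filter]
      refine prod_congr rfl fun i _ => ?_
      by_cases h : i < σ i <;> simp [h]
    have h2 : ∏ j, ξ (ofLex (keyAt σ s (σ.symm j))).1 = ∏ i, ξ (s i) := by
      rw [← Equiv.prod_comp σ]
      simp only [Equiv.symm_apply_apply, keyAt, ofLex_toLex]
    rw [h1, h2]

theorem sum_single_eq_content {m n : ℕ} (v : Fin n → Fin m) :
    ∑ j, Finsupp.single (v j) 1 = Finsupp.equivFunOnFinite.symm (content v) := by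
  classical
  ext k
  rw [Finsupp.finsetSum_apply, Finsupp.equivFunOnFinite_symm_apply_apply, content, card_filter]
  exact sum_congr rfl fun j _ => Finsupp.single_apply

theorem coeff_prod_sum_letters {m n : ℕ} {κ : Type*} [Fintype κ] (e : κ → Fin m)
    (g : Fin n → κ → B) (a : Fin m → ℕ) :
    MvPolynomial.coeff (Finsupp.equivFunOnFinite.symm a)
      (∏ j, ∑ x, MvPolynomial.C (g j x) * MvPolynomial.X (e x)) =
      ∑ c : Fin n → κ with content (fun j => e (c j)) = a, ∏ j, g j (c j) := by
  classical
  rw [prod_univ_sum, Fintype.piFinset_univ, MvPolynomial.coeff_sum, sum_filter]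
  refine sum_congr rfl fun c _ => ?_
  have h1 : ∏ j, (MvPolynomial.C (g j (c j)) * MvPolynomial.X (e (c j))) =
      MvPolynomial.monomial (Finsupp.equivFunOnFinite.symm (content fun j => e (c j)))
        (∏ j, g j (c j)) := by
    rw [← sum_single_eq_content, MvPolynomial.monomial_sum_index]
    simp only [MvPolynomial.X, prod_mul_distrib, map_prod]
  rw [h1, MvPolynomial.coeff_monomial]
  simp

theorem sum_content {m n : ℕ} (v : Fin n → Fin m) : ∑ k, content v k = n := by
  have := card_eq_sum_card_fiberwise (s := (univ : Finset (Fin n))) (t := univ) (f := v)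
    fun _ _ => mem_univ _
  simpa [content] using this.symm

theorem prod_fin_sum {M : Type*} [CommMonoid M] {m : ℕ} (a : Fin m → ℕ) (f : ℕ → M) :
    ∏ j : Fin (∑ k, a k), f j = ∏ k, ∏ r : Fin (a k), f (sumBelow a k + r) := by
  rw [← Equiv.prod_comp finSigmaFinEquiv, Fintype.prod_sigma]
  refine prod_congr rfl fun k _ => prod_congr rfl fun r _ => ?_
  rw [finSigmaFinEquiv_apply]
  congr 2
  rw [sumBelow]
  refine sum_bij (fun i _ => Fin.castLE k.2.le i) ?_ ?_ ?_ ?_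
  · intro i _
    simp only [mem_filter, mem_univ, true_and, Fin.lt_def]
    exact i.2
  · intro i _ j _ h; simpa using h
  · intro i hi
    simp only [mem_filter, mem_univ, true_and, Fin.lt_def] at hi
    exact ⟨⟨i, hi⟩, mem_univ _, rfl⟩
  · intro i _; rfl

/-- At a position in block `k`, a letter of value below `k` must be an excedance, one above `k` a
non-excedance, and `k` itself may be either. The exception is the first position of the block, where
the strict inequality forbids the excedance. -/
theorem sum_letterWeight {m : ℕ} (t : B) (a : Fin m → ℕ) (k : Fin m) {r : ℕ} (hr : r < a k) :
    ∑ x : Lex (Fin m × Bool), MvPolynomial.C (letterWeight t a (sumBelow a k + r) x) *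
      MvPolynomial.X (ofLex x).1 =
      if r = 0 then weightForm t (1 + t) 1 k - MvPolynomial.C t * MvPolynomial.X k
      else weightForm t (1 + t) 1 k := by
  have h1 : ∀ l : Fin m, k < l → sumBelow a k + r < sumBelow a l := by
    intro l hl
    calc sumBelow a k + r < sumBelow a k + a k := by omega
      _ = ∑ i ∈ insert k ({i | i < k} : Finset (Fin m)), a i := by rw [sum_insert (by simp), add_comm, sumBelow]
      _ ≤ sumBelow a l := by
        refine sum_le_sum_of_subset fun i hi => ?_
        simp only [mem_insert, mem_filter, mem_univ, true_and] at hi ⊢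
        rcases hi with rfl | hi
        · exact hl
        · exact hi.trans hl
  have h2 : ∀ l : Fin m, sumUpTo a l = sumBelow a l + a l := by
    intro l
    have : ({i | i ≤ l} : Finset (Fin m)) = insert l ({i | i < l} : Finset (Fin m)) := by
      ext i; simp [le_iff_eq_or_lt]
    rw [sumUpTo, this, sum_insert (by simp), add_comm, sumBelow]
  have h3 : ∀ l : Fin m, l < k → sumUpTo a l ≤ sumBelow a k := by
    intro l hl
    refine sum_le_sum_of_subset fun i hi => ?_
    simp only [mem_filter, mem_univ, true_and] at hi ⊢
    exact hi.trans_lt hl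
  have h4 : ∑ x : Lex (Fin m × Bool),
      MvPolynomial.C (letterWeight t a (sumBelow a k + r) x) * MvPolynomial.X (ofLex x).1 =
      ∑ l : Fin m, MvPolynomial.C (if l < k then t else if l = k then
        (if r = 0 then 1 else 1 + t) else 1) * (MvPolynomial.X l : MvPolynomial (Fin m) B) := by
    rw [← Equiv.sum_comp toLex, Fintype.sum_prod_type]
    refine sum_congr rfl fun l _ => ?_
    rw [Fintype.sum_bool]
    rw [letterWeight_true, letterWeight_false, ofLex_toLex, ofLex_toLex]
    rw [← add_mul, ← MvPolynomial.C_add]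
    refine congrArg (fun b => MvPolynomial.C b * MvPolynomial.X l) ?_
    rcases lt_trichotomy l k with h | rfl | h
    · have h5 := h3 l h
      have h6 := h2 l
      -- The second alternative in `letterWeight` matters only here: if `a l = 0`, the bound
      -- `sumBelow a l < j` can fail at `j = sumUpTo a l`. Such a letter never occurs in a word of
      -- content `a`, so giving it weight `t` is harmless and keeps the form uniform.
      rw [if_neg (by omega), if_pos (by omega), if_pos h, zero_add]
    · rw [if_pos (by rw [h2]; omega), if_neg (lt_irrefl _), if_pos rfl, h2]
      split_ifs with h6 h7 h7
      · omega
      · rfl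
      · rw [add_zero]
      · omega
    · have h5 := h1 l h
      have h6 := h2 l
      rw [if_pos (by omega), if_neg (by omega), if_neg h.not_gt, if_neg h.ne', add_zero]
  rw [h4]
  split_ifs with h5
  · have h6 : (MvPolynomial.C t * MvPolynomial.X k : MvPolynomial (Fin m) B) =
        ∑ l, MvPolynomial.C (if l = k then t else 0) * MvPolynomial.X l := by
      rw [sum_eq_single k (fun l _ hl => by simp [hl]) (by simp), if_pos rfl]
    rw [weightForm, h6, ← sum_sub_distrib]
    refine sum_congr rfl fun l _ => ?_
    rw [← sub_mul, ← MvPolynomial.C_sub]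
    congr 2
    rcases lt_trichotomy l k with h | rfl | h
    · simp [h, h.ne]
    · simp
    · simp [h.ne', h.not_gt]
  · rfl

theorem prod_ite_zero_eq_modifiedPow {S : Type*} [CommRing S] (w e : S) (b : ℕ) :
    ∏ r : Fin b, (if (r : ℕ) = 0 then w - e else w) = modifiedPow w e b := by
  rcases b with _ | b
  · simp [modifiedPow]
  · simp [Fin.prod_univ_succ, modifiedPow]

/-- For fixed `a` the weight of a word is a product over positions, so the sum is a coefficient of a
product of linear forms. Cutting the positions into consecutive blocks of lengths `a k` makes the
form constant on each block, apart from its first position. -/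
theorem sum_words_with_content {m n : ℕ} (t : B) (a : Fin m → ℕ) (ha : ∑ k, a k = n) :
    ∑ c : Fin n → Lex (Fin m × Bool) with content (fun j => (ofLex (c j)).1) = a,
      ∏ j : Fin n, letterWeight t a j (c j) = blockCoeff t (1 + t) 1 t a := by
  subst ha
  rw [← coeff_prod_sum_letters (fun x : Lex (Fin m × Bool) => (ofLex x).1)
    (fun j x => letterWeight t a j x), blockCoeff, blockProd,
    prod_fin_sum a fun j => ∑ x : Lex (Fin m × Bool),
      MvPolynomial.C (letterWeight t a j x) * MvPolynomial.X (ofLex x).1]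
  congr 1
  refine prod_congr rfl fun k _ => ?_
  rw [← prod_ite_zero_eq_modifiedPow]
  exact prod_congr rfl fun r _ => sum_letterWeight t a k r.2

theorem permSum_eq_sum_blockCoeff {m : ℕ} (t : B) (ξ : Fin m → B) (n : ℕ) :
    permSum t ξ n = ∑ a ∈ piAntidiag (univ : Finset (Fin m)) n,
      (∏ k, ξ k ^ a k) * blockCoeff t (1 + t) 1 t a := by
  classical
  rw [permSum_eq_sum_words, ← sum_fiberwise_of_maps_to (t := piAntidiag (univ : Finset (Fin m)) n)
    (g := fun c : Fin n → Lex (Fin m × Bool) => content fun j => (ofLex (c j)).1)]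
  · refine sum_congr rfl fun a ha => ?_
    rw [← sum_words_with_content t a (mem_piAntidiag.1 ha).1, mul_sum]
    refine sum_congr rfl fun c hc => ?_
    rw [sum_content_weight ξ fun j => (ofLex (c j)).1, (mem_filter.1 hc).2, mul_comm]
  · intro c _
    exact mem_piAntidiag.2 ⟨sum_content _, fun _ _ => mem_univ _⟩

end Words

/-! ### Generating function of permutations with compatible sequences -/

section GeneratingFunction

open Finset

variable {B : Type*} [CommRing B]

/-- The generating function of `permSum` is `(1-t) ∏(1-tξ_k z) / (∏(1-ξ_k z) - t ∏(1-tξ_k z))`. -/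
theorem mk_permSum_mul {m : ℕ} (t : B) (ξ : Fin m → B) :
    PowerSeries.mk (permSum t ξ) *
      (∏ k, (1 - PowerSeries.C (ξ k) * PowerSeries.X) -
        PowerSeries.C t * ∏ k, (1 - PowerSeries.C (t * ξ k) * PowerSeries.X)) =
      (1 - PowerSeries.C t) * ∏ k, (1 - PowerSeries.C (t * ξ k) * PowerSeries.X) := by
  -- Working modulo `z^N` makes the arguments `ξ_k z` nilpotent, as the finite master formula
  -- requires.
  have key : ∀ N : ℕ, (PowerSeries.X : PowerSeries B) ^ N ∣ PowerSeries.mk (permSum t ξ) *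
      (∏ k, (1 - PowerSeries.C (ξ k) * PowerSeries.X) -
        PowerSeries.C t * ∏ k, (1 - PowerSeries.C (t * ξ k) * PowerSeries.X)) -
      (1 - PowerSeries.C t) * ∏ k, (1 - PowerSeries.C (t * ξ k) * PowerSeries.X) := by
    intro N
    rw [← Ideal.mem_span_singleton, ← Ideal.Quotient.eq_zero_iff_mem]
    set π := Ideal.Quotient.mk (Ideal.span {(PowerSeries.X : PowerSeries B) ^ N}) with hπ
    have hX : π PowerSeries.X ^ N = 0 := by
      rw [← map_pow, hπ, Ideal.Quotient.eq_zero_iff_mem]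
      exact Ideal.mem_span_singleton_self _
    have h1 : π (PowerSeries.mk (permSum t ξ)) =
        ∑ n ∈ range N, π (PowerSeries.C (permSum t ξ n)) * π PowerSeries.X ^ n := by
      rw [← sub_eq_zero]
      simp only [← map_pow, ← map_mul, ← map_sum, ← map_sub]
      rw [hπ, Ideal.Quotient.eq_zero_iff_mem, Ideal.mem_span_singleton, PowerSeries.X_pow_dvd_iff]
      intro n hn
      simp [PowerSeries.coeff_X_pow, hn]
    -- With `p = t`, `d = 1 + t`, `u = 1`, `τ = t` the differences are `d - p = 1`, `d - u = t` and
    -- `u - p = 1 - t`.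
    have h2 := sum_blockCoeff_mul (N := N) (fun k => π (PowerSeries.C (ξ k) * PowerSeries.X))
      (fun k => by rw [map_mul, mul_pow, hX, mul_zero]) (π (PowerSeries.C t))
      (π (PowerSeries.C (1 + t))) (π (PowerSeries.C 1)) (π (PowerSeries.C t))
    have h3 : ∑ a ∈ Fintype.piFinset fun _ : Fin m => range N,
        (∏ k, π (PowerSeries.C (ξ k) * PowerSeries.X) ^ a k) *
          blockCoeff (π (PowerSeries.C t)) (π (PowerSeries.C (1 + t))) (π (PowerSeries.C 1))
            (π (PowerSeries.C t)) a = π (PowerSeries.mk (permSum t ξ)) := by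
      have h4 : ∀ a : Fin m → ℕ, (∏ k, π (PowerSeries.C (ξ k) * PowerSeries.X) ^ a k) *
          blockCoeff (π (PowerSeries.C t)) (π (PowerSeries.C (1 + t))) (π (PowerSeries.C 1))
            (π (PowerSeries.C t)) a = π (PowerSeries.C ((∏ k, ξ k ^ a k) *
              blockCoeff t (1 + t) 1 t a)) * π PowerSeries.X ^ (∑ k, a k) := by
        intro a
        have h5 := map_blockCoeff (π.comp (PowerSeries.C (R := B))) t (1 + t) 1 t a
        simp only [RingHom.comp_apply] at h5
        rw [← h5, map_mul, map_mul, map_prod, map_prod, ← prod_pow_eq_pow_sum, mul_right_comm,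
          ← prod_mul_distrib]
        simp only [map_mul, map_pow, mul_pow]
      rw [h1]
      simp only [h4, permSum_eq_sum_blockCoeff, map_sum, sum_mul]
      rw [sum_sigma']
      symm
      -- One sum is over `∑ a_k < N`, the other over the larger box `a_k < N`. The extra terms
      -- contain `z^N`.
      refine sum_bij_ne_zero (fun p _ _ => p.2) ?_ ?_ ?_ ?_
      · rintro ⟨n, a⟩ hp _
        simp only [mem_sigma, mem_range, mem_piAntidiag] at hp
        rw [Fintype.mem_piFinset]
        intro k
        rw [mem_range]
        refine lt_of_le_of_lt ?_ hp.1
        rw [← hp.2.1]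
        exact single_le_sum (fun _ _ => Nat.zero_le _) (mem_univ k)
      · rintro ⟨n, a⟩ hp _ ⟨n', a'⟩ hp' _ h
        simp only [mem_sigma, mem_range, mem_piAntidiag] at hp hp' h
        subst h
        rw [← hp.2.1, ← hp'.2.1]
      · intro a _ hne
        have hlt : ∑ k, a k < N := by
          by_contra hc
          refine hne ?_
          rw [← Nat.add_sub_cancel' (not_lt.1 hc), pow_add, hX, zero_mul, mul_zero]
        have hs : (⟨∑ k, a k, a⟩ : (_ : ℕ) × (Fin m → ℕ)) ∈
            (range N).sigma fun n => piAntidiag univ n := by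
          simp [hlt]
        exact ⟨⟨∑ k, a k, a⟩, hs, hne, rfl⟩
      · rintro ⟨n, a⟩ hp _
        simp only [mem_sigma, mem_range, mem_piAntidiag] at hp
        rw [← hp.2.1]
    rw [h3] at h2
    rw [map_sub, sub_eq_zero]
    simp only [map_mul, map_sub, map_one, map_prod, map_add, add_sub_cancel_right, one_mul,
      add_sub_cancel_left] at h2 ⊢
    simp only [mul_assoc] at h2 ⊢
    exact h2
  ext n
  have := PowerSeries.X_pow_dvd_iff.1 (key (n + 1)) n n.lt_succ_self
  rwa [map_sub, sub_eq_zero] at this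

end GeneratingFunction

end EulerianSym

end
noncomputable section

namespace EulerianSym

/-! ### The major index and compatible sequences -/

section Maj

open Finset

theorem sum_mul_sub_succ (e : ℕ → ℤ) (N : ℕ) :
    ∑ i ∈ range N, ((i : ℤ) + 1) * (e i - e (i + 1)) = ∑ i ∈ range N, e i - N * e N := by
  induction N with
  | zero => simp
  | succ N ih =>
    rw [sum_range_succ, ih, sum_range_succ]
    push_cast
    ring

/-- An excedance followed by a non-excedance is always a descent, and the reverse pattern never is.
So the indicators of `descents` and `dexSet` differ at `i` by `e i - e (i + 1)`, with `e` the
excedance indicator, and Abel summation turns the difference of the two sums into `∑ e i`. -/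
theorem sum_dexSet_add_exc {n : ℕ} (σ : Equiv.Perm (Fin n)) :
    ∑ i ∈ dexSet σ, ((i : ℕ) + 1) + exc σ = maj σ := by
  classical
  set e : ℕ → ℤ := fun i => if h : i < n then (if (⟨i, h⟩ : Fin n) < σ ⟨i, h⟩ then 1 else 0) else 0
    with he
  have h1 : ∀ i : Fin n, (if i ∈ descents σ then 1 else 0 : ℤ) - (if i ∈ dexSet σ then 1 else 0) =
      e i - e (i + 1) := by
    intro i
    have hi : e i = if i < σ i then 1 else 0 := by simp [he]
    by_cases h : (i : ℕ) + 1 < n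
    · have hne : (σ i : ℕ) ≠ σ ⟨i + 1, h⟩ := fun hc => by
        have := congrArg Fin.val (σ.injective (Fin.ext hc))
        simp at this
      have hi' : e (i + 1) = if (⟨i + 1, h⟩ : Fin n) < σ ⟨i + 1, h⟩ then 1 else 0 := by
        simp [he, h]
      rw [hi, hi']
      simp only [descents, dexSet, mem_filter, mem_univ, true_and, h, exists_true_left]
      by_cases h1 : i < σ i <;> by_cases h2 : (⟨i + 1, h⟩ : Fin n) < σ ⟨i + 1, h⟩ <;>
      by_cases h3 : σ ⟨i + 1, h⟩ < σ i <;> simp [h1, h2, h3] <;>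
      simp only [Fin.lt_def] at * <;> omega
    · have hi' : e (i + 1) = 0 := by simp [he, h]
      have h2 : ¬ i < σ i := by
        have := (σ i).isLt
        rw [Fin.lt_def]
        omega
      rw [hi, hi']
      simp [descents, dexSet, h, h2]
  have h2 := sum_mul_sub_succ e n
  have h3 : e n = 0 := by simp [he]
  have h4 : ∑ i ∈ range n, e i = exc σ := by
    rw [← Fin.sum_univ_eq_sum_range, exc, excedances, card_filter]
    push_cast
    exact sum_congr rfl fun i _ => by simp [he]
  rw [h3, mul_zero, sub_zero, h4, ← Fin.sum_univ_eq_sum_range fun i =>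
    ((i : ℤ) + 1) * (e i - e (i + 1))] at h2
  simp only [← h1, mul_sub, sum_sub_distrib, mul_ite, mul_one, mul_zero, sum_ite_mem,
    univ_inter] at h2
  rw [maj]
  zify
  linarith

end Maj

/-! ### Summation over compatible sequences by their gaps -/

section Gaps

open Finset

variable {A : Type*} [CommRing A]

/-- The tail sum `∑_{j ≥ i} g_j`. -/
def tailSum {n : ℕ} (g : Fin n → ℕ) (i : ℕ) : ℕ := ∑ j ∈ ({j : Fin n | i ≤ (j : ℕ)} : Finset (Fin n)), g j

theorem tailSum_self {n : ℕ} (g : Fin n → ℕ) : tailSum g n = 0 := by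
  rw [tailSum, filter_false_of_mem, sum_empty]
  intro j _
  exact not_le.2 j.2

theorem tailSum_eq_add {n : ℕ} (g : Fin n → ℕ) (i : Fin n) :
    tailSum g i = tailSum g (i + 1) + g i := by
  have : ({j : Fin n | (i : ℕ) ≤ j} : Finset (Fin n)) =
      insert i ({j | (i : ℕ) + 1 ≤ j} : Finset (Fin n)) := by
    ext j
    simp only [mem_filter, mem_univ, true_and, mem_insert, Fin.ext_iff]
    omega
  rw [tailSum, this, sum_insert (by simp), add_comm, tailSum]

theorem sum_tailSum {n : ℕ} (g : Fin n → ℕ) :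
    ∑ i : Fin n, tailSum g i = ∑ j : Fin n, ((j : ℕ) + 1) * g j := by
  simp only [tailSum, sum_filter]
  rw [sum_comm]
  refine sum_congr rfl fun j _ => ?_
  rw [← sum_filter, sum_const, smul_eq_mul]
  congr 1
  rw [← Fin.card_Iic]
  congr 1
  ext i
  simp only [mem_filter, mem_univ, true_and, mem_Iic, Fin.le_def]

theorem eq_tailSum {n : ℕ} (g : Fin n → ℕ) (r : ℕ → ℕ) (h0 : r n = 0)
    (h : ∀ i : Fin n, r i = r (i + 1) + g i) {i : ℕ} (hi : i ≤ n) : r i = tailSum g i := by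
  obtain ⟨k, hk⟩ : ∃ k, i + k = n := ⟨n - i, by omega⟩
  induction k generalizing i with
  | zero => obtain rfl : i = n := hk; rw [h0, tailSum_self]
  | succ k ih =>
    have h1 := h ⟨i, by omega⟩
    have h2 := tailSum_eq_add g ⟨i, by omega⟩
    simp only at h1 h2
    rw [h1, h2, ih (by omega) (by omega)]

theorem pow_eq_zero_of_exponent {q : A} {M k : ℕ} (hq : q ^ M = 0) (h : q ^ k ≠ 0) : k < M := by
  by_contra hc
  exact h (pow_eq_zero_of_le (not_lt.1 hc) hq)

/-- The exponents `r i = M - s i` decrease weakly, and are determined by the drops `r i - r (i + 1)`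
with `r n = 0`. Each drop is a free `g i` plus the compulsory `1` on `D`. A drop at `i` counts `i +
1` times in `∑ r i`. Truncating `g` at `M` and `s` at `Fin (M + 1)` agree because `q ^ (M + 1) = 0`.
-/
theorem sum_compat_eq_sum_gaps {M n : ℕ} {q : A} (hq : q ^ (M + 1) = 0) (D : Finset (Fin n))
    (hD : ∀ i ∈ D, (i : ℕ) + 1 < n) :
    ∑ s : Fin n → Fin (M + 1) with Compat D s, ∏ i, q ^ (M - (s i : ℕ)) =
      ∑ g ∈ Fintype.piFinset fun _ : Fin n => range (M + 1),
        q ^ (∑ i ∈ D, ((i : ℕ) + 1)) * ∏ i : Fin n, (q ^ ((i : ℕ) + 1)) ^ g i := by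
  classical
  set δ : Fin n → ℕ := fun i => if i ∈ D then 1 else 0 with hδ
  have hexp : ∀ g : Fin n → ℕ, q ^ (∑ i ∈ D, ((i : ℕ) + 1)) * ∏ i : Fin n, (q ^ ((i : ℕ) + 1)) ^ g i =
      q ^ (∑ i : Fin n, tailSum (g + δ) i) := by
    intro g
    simp only [← pow_mul]
    rw [prod_pow_eq_pow_sum, ← pow_add, sum_tailSum]
    congr 1
    simp only [Pi.add_apply, mul_add, sum_add_distrib, hδ, mul_ite, mul_one, mul_zero, sum_ite_mem,
      univ_inter]
    ring
  simp only [hexp, prod_pow_eq_pow_sum]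
  symm
  have hr : ∀ g : Fin n → ℕ, q ^ (∑ i : Fin n, tailSum (g + δ) i) ≠ 0 → ∀ i : Fin n,
      tailSum (g + δ) i ≤ M := by
    intro g hg i
    have h1 := pow_eq_zero_of_exponent hq hg
    have h2 := single_le_sum (f := fun i : Fin n => tailSum (g + δ) i) (fun _ _ => Nat.zero_le _)
      (mem_univ i)
    omega
  refine sum_bij_ne_zero (fun g _ _ i => ⟨M - tailSum (g + δ) i, by omega⟩) ?_ ?_ ?_ ?_
  · intro g _ hne
    simp only [mem_filter, mem_univ, true_and]
    intro i h
    have h1 := tailSum_eq_add (g + δ) i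
    have h2 := hr g hne i
    simp only [Pi.add_apply, hδ] at h1 h2 ⊢
    omega
  · intro g _ hne g' _ hne' h
    have h1 : ∀ i : ℕ, i ≤ n → tailSum (g + δ) i = tailSum (g' + δ) i := by
      intro i hi
      rcases hi.eq_or_lt with rfl | hi
      · rw [tailSum_self, tailSum_self]
      · have h2 := congrArg Fin.val (congrFun h ⟨i, hi⟩)
        have h3 := hr g hne ⟨i, hi⟩
        have h4 := hr g' hne' ⟨i, hi⟩
        simp only at h2 h3 h4
        omega
    ext i
    have h2 := tailSum_eq_add (g + δ) i
    have h3 := tailSum_eq_add (g' + δ) i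
    rw [h1 i i.2.le, h1 (i + 1) i.2] at h2
    simp only [Pi.add_apply] at h2 h3
    omega
  · intro s hs hne
    simp only [mem_filter, mem_univ, true_and] at hs
    set r : ℕ → ℕ := fun i => if h : i < n then M - (s ⟨i, h⟩ : ℕ) else 0 with hr'
    have hr1 : ∀ i : Fin n, r i = M - (s i : ℕ) := fun i => by simp [hr']
    have hstep : ∀ i : Fin n, r (i + 1) + δ i ≤ r i := by
      intro i
      rw [hr1]
      by_cases h : (i : ℕ) + 1 < n
      · have h1 := hs i h
        have h2 : r (i + 1) = M - (s ⟨i + 1, h⟩ : ℕ) := by simp [hr', h]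
        have h3 := (s ⟨i + 1, h⟩).2
        rw [h2]
        simp only [hδ] at h1 ⊢
        omega
      -- At the last position compatibility imposes nothing; `hD` guarantees that no drop is
      -- compulsory there.
      · have h1 : r (i + 1) = 0 := by simp [hr', h]
        have h2 : δ i = 0 := if_neg fun hc => h (hD i hc)
        omega
    set g : Fin n → ℕ := fun i => r i - r (i + 1) - δ i with hg
    have h1 : ∀ i : ℕ, i ≤ n → r i = tailSum (g + δ) i := by
      intro i hi
      refine eq_tailSum _ r (by simp [hr']) (fun i => ?_) hi
      have := hstep i
      simp only [Pi.add_apply, hg]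
      omega
    have h2 : ∑ i : Fin n, tailSum (g + δ) i = ∑ i, (M - (s i : ℕ)) :=
      sum_congr rfl fun i _ => by rw [← h1 i i.2.le, hr1]
    refine ⟨g, ?_, by rwa [h2], ?_⟩
    · rw [Fintype.mem_piFinset]
      intro i
      rw [mem_range]
      have := hr1 i
      simp only [hg]
      omega
    · ext i
      have h3 := (s i).2
      simp only
      rw [← h1 i i.2.le, hr1]
      omega
  · intro g _ hne
    congr 1
    refine sum_congr rfl fun i _ => ?_
    have := hr g hne i
    simp only
    omega

theorem prod_range_succ_eq_prod_Icc (f : ℕ → A) (n : ℕ) :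
    ∏ i ∈ range n, f (i + 1) = ∏ i ∈ Icc 1 n, f i := by
  induction n with
  | zero => simp
  | succ n ih => rw [prod_range_succ, prod_Icc_succ_top (by omega), ih]

theorem sum_compat_mul {M n : ℕ} {q : A} (hq : q ^ (M + 1) = 0) (D : Finset (Fin n))
    (hD : ∀ i ∈ D, (i : ℕ) + 1 < n) :
    (∑ s : Fin n → Fin (M + 1) with Compat D s, ∏ i, q ^ (M - (s i : ℕ))) *
      ∏ i ∈ Icc 1 n, (1 - q ^ i) = q ^ (∑ i ∈ D, ((i : ℕ) + 1)) := by
  rw [sum_compat_eq_sum_gaps hq D hD, ← mul_sum, ← prod_univ_sum, mul_assoc,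
    ← prod_range_succ_eq_prod_Icc fun i => 1 - q ^ i,
    prod_range fun i => (1 - q ^ (i + 1)), ← prod_mul_distrib, prod_eq_one, mul_one]
  intro i _
  rw [geom_sum_mul_neg, ← pow_mul, mul_comm, pow_mul, hq, zero_pow (by omega), sub_zero]

end Gaps

end EulerianSym

end
noncomputable section

namespace EulerianSym

/-! ### The generating function of the q-Eulerian polynomials -/

section QSeries

open Finset

variable (R : Type*) [CommRing R]

theorem one_sub_X_mul_qNat (n : ℕ) :
    (1 - PowerSeries.X) * (qNat R n : PowerSeries R) = 1 - PowerSeries.X ^ n := by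
  have h1 : (1 - Polynomial.X) * qNat R n = 1 - Polynomial.X ^ n := mul_neg_geom_sum _ _
  have h2 := congrArg (Polynomial.coeToPowerSeries.ringHom (R := R)) h1
  simpa using h2

theorem qPochhammer_eq (n : ℕ) :
    qPochhammer R n = (1 - PowerSeries.X) ^ n * (qFactorial R n : PowerSeries R) := by
  induction n with
  | zero => simp [qPochhammer, qFactorial]
  | succ n ih =>
    rw [qPochhammer_succ, ih, qFactorial_succ, Polynomial.coe_mul, ← one_sub_X_mul_qNat]
    ring

/-- The powers of `1 - q` relating q-factorials to `(1-q)⋯(1-q^n)` cancel, so the factorial formula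
persists. This turns the binomial sum in `Ã_n` into the convolution with `h_(n-m)` in `Q̃_n`. -/
theorem qBinomial_mul_qPochhammerInv {n m : ℕ} (hm : m ≤ n) :
    (qBinomial R n m : PowerSeries R) * qPochhammerInv R n =
      qPochhammerInv R m * qPochhammerInv R (n - m) := by
  have h1 : (qBinomial R n m : PowerSeries R) * (qPochhammer R m * qPochhammer R (n - m)) =
      qPochhammer R n := by
    have h2 := congrArg (Polynomial.coeToPowerSeries.ringHom (R := R)) (qBinomial_mul R hm)
    simp only [Polynomial.coeToPowerSeries.ringHom_apply, Polynomial.coe_mul] at h2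
    rw [qPochhammer_eq, qPochhammer_eq, qPochhammer_eq, ← h2]
    have h3 : (1 - PowerSeries.X : PowerSeries R) ^ n =
      (1 - PowerSeries.X) ^ m * (1 - PowerSeries.X) ^ (n - m) := by
      rw [← pow_add, Nat.add_sub_cancel' hm]
    rw [h3]
    ring
  have e1 := qPochhammer_mul_inv R n
  have e2 := qPochhammer_mul_inv R m
  have e3 := qPochhammer_mul_inv R (n - m)
  set b : PowerSeries R := (qBinomial R n m : PowerSeries R)
  set P := qPochhammer R n
  set P1 := qPochhammer R m
  set P2 := qPochhammer R (n - m)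
  set a := qPochhammerInv R n
  set a1 := qPochhammerInv R m
  set a2 := qPochhammerInv R (n - m)
  have h4 : b * a = b * a * (P1 * a1) * (P2 * a2) := by rw [e2, e3, mul_one, mul_one]
  calc b * a = (b * (P1 * P2)) * a * (a1 * a2) := by rw [h4]; ring
    _ = a1 * a2 := by rw [h1, e1, one_mul]

/-- `A_n(q,t) / ((1-q) ⋯ (1-q^n))`. -/
def normalizedEulerian (n : ℕ) : Polynomial (PowerSeries R) :=
  Polynomial.map Polynomial.coeToPowerSeries.ringHom (qEulerian R n) *
    Polynomial.C (qPochhammerInv R n)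

theorem psPoly_Qtilde_of_psPoly_Q (n : ℕ)
    (hQ : ∀ m, psPoly R (Q R m) = normalizedEulerian R m) :
    psPoly R (Qtilde R n) =
      Polynomial.map Polynomial.coeToPowerSeries.ringHom (qBinomialEulerian R n) *
        Polynomial.C (qPochhammerInv R n) := by
  have hh : ∀ k, psHom R (h R k) = qPochhammerInv R k := ps_h
  simp only [psPoly_eq_map] at hQ ⊢
  rw [Qtilde, qBinomialEulerian]
  simp only [Polynomial.map_add, Polynomial.map_mul, Polynomial.map_X, Polynomial.map_C,
    Polynomial.map_sum, Polynomial.map_one, hQ, hh]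
  rw [add_mul, one_mul, mul_assoc, sum_mul]
  refine congrArg (fun p => _ + Polynomial.X * p) (sum_congr rfl fun m hm => ?_)
  have h1 := congrArg (Polynomial.C (R := PowerSeries R))
    (qBinomial_mul_qPochhammerInv R (mem_Icc.1 hm).2)
  rw [Polynomial.C_mul, Polynomial.C_mul] at h1
  rw [normalizedEulerian, Polynomial.coeToPowerSeries.ringHom_apply]
  have h2 : ∀ A b c x y : Polynomial (PowerSeries R), b * c = x * y → y * (A * x) = b * A * c := by
    intro A b c x y h
    rw [mul_left_comm, mul_comm y, ← h, mul_left_comm, mul_assoc]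
  exact h2 _ _ _ _ _ h1

/-- `∑ z^n / ((1-q) ⋯ (1-q^n))`. -/
def qExp : PowerSeries (Polynomial (PowerSeries R)) :=
  PowerSeries.mk fun n => Polynomial.C (qPochhammerInv R n)

theorem psPoly_Q_of_qExp
    (hE : (PowerSeries.rescale Polynomial.X (qExp R) - PowerSeries.C Polynomial.X * qExp R) *
      PowerSeries.mk (normalizedEulerian R) = PowerSeries.C (1 - Polynomial.X) * qExp R) (n : ℕ) :
    psPoly R (Q R n) = normalizedEulerian R n := by
  have h0 : qPochhammerInv R 0 = 1 := by rw [← ps_h, ps_h_zero]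
  have h1 := (existsUnique_Q R).choose_spec.1
  change (Htz R - PowerSeries.C Polynomial.X * H R) * QSeries R = _ at h1
  have hH : PowerSeries.map (Polynomial.mapRingHom (psHom R)) (H R) = qExp R := by
    ext1 n
    rw [PowerSeries.coeff_map, H, qExp, PowerSeries.coeff_mk, PowerSeries.coeff_mk,
      Polynomial.coe_mapRingHom, Polynomial.map_C]
    exact congrArg _ (ps_h n)
  have hHt : PowerSeries.map (Polynomial.mapRingHom (psHom R)) (Htz R) =
      PowerSeries.rescale Polynomial.X (qExp R) := by
    ext1 n
    rw [← hH, Htz, PowerSeries.coeff_rescale, PowerSeries.coeff_map, PowerSeries.coeff_map,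
      PowerSeries.coeff_rescale, map_mul, map_pow, Polynomial.coe_mapRingHom, Polynomial.map_X]
  have h2 := congrArg (PowerSeries.map (Polynomial.mapRingHom (psHom R))) h1
  simp only [map_mul, map_sub, hH, hHt, PowerSeries.map_C, Polynomial.coe_mapRingHom,
    Polynomial.map_X, Polynomial.map_sub, Polynomial.map_one] at h2
  rw [← map_sub] at h2
  have h3 := (existsUnique_quotient (qPochhammerInv R) h0).unique h2 hE
  have h4 := congrArg (PowerSeries.coeff n) h3
  rwa [PowerSeries.coeff_map, PowerSeries.coeff_mk, Polynomial.coe_mapRingHom,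
    ← psPoly_eq_map] at h4

end QSeries

/-! ### Product formula modulo a power of q -/

section Truncation

open Finset

variable {B : Type*} [CommRing B]

/-- The recursion for `a` is the functional equation `(1 - z) E(z) = E(qz)`, here iterated `j`
times. -/
theorem prod_range_mul_eq_rescale {q : B} {a : ℕ → B}
    (ha : ∀ n, a (n + 1) = a n + q ^ (n + 1) * a (n + 1)) (j : ℕ) :
    (∏ k ∈ range j, (1 - PowerSeries.C (q ^ k) * PowerSeries.X)) * PowerSeries.mk a =
      PowerSeries.rescale (q ^ j) (PowerSeries.mk a) := by
  induction j with
  | zero => simp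
  | succ j ih =>
    rw [prod_range_succ, mul_right_comm, ih]
    ext n
    rw [mul_sub, mul_one, map_sub, mul_left_comm, PowerSeries.coeff_C_mul]
    rcases n with _ | n
    · simp
    · rw [PowerSeries.coeff_succ_mul_X]
      simp only [PowerSeries.coeff_rescale, PowerSeries.coeff_mk]
      have := ha n
      linear_combination (q ^ j) ^ (n + 1) * this

/-- After `M + 1` iterations the argument `q^(M+1) z` is `0`, and `E(0) = 1`. The alphabet is listed
in reverse to match the exponents `M - s i` of the compatible sequences. -/
theorem prod_mul_mk_eq_one {q : B} {M : ℕ} (hq : q ^ (M + 1) = 0) {a : ℕ → B} (h0 : a 0 = 1)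
    (ha : ∀ n, a (n + 1) = a n + q ^ (n + 1) * a (n + 1)) :
    (∏ k : Fin (M + 1), (1 - PowerSeries.C (q ^ (M - (k : ℕ))) * PowerSeries.X)) *
      PowerSeries.mk a = 1 := by
  have h1 := prod_range_mul_eq_rescale ha (M + 1)
  rw [hq, PowerSeries.rescale_zero, RingHom.comp_apply, ← PowerSeries.coeff_zero_eq_constantCoeff_apply,
    PowerSeries.coeff_mk, h0, map_one] at h1
  rw [Fin.prod_univ_eq_prod_range fun k => 1 - PowerSeries.C (q ^ (M - k)) * PowerSeries.X]
  rw [← prod_range_reflect] at h1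
  simpa only [Nat.add_sub_cancel] using h1

theorem rescale_C (t b : B) : PowerSeries.rescale t (PowerSeries.C b) = PowerSeries.C b := by
  ext n
  rw [PowerSeries.coeff_rescale, PowerSeries.coeff_C]
  split_ifs with h <;> simp [h]

theorem rescale_mul_permSum {q t : B} {M : ℕ} (hq : q ^ (M + 1) = 0) {a : ℕ → B} (h0 : a 0 = 1)
    (ha : ∀ n, a (n + 1) = a n + q ^ (n + 1) * a (n + 1)) :
    (PowerSeries.rescale t (PowerSeries.mk a) - PowerSeries.C t * PowerSeries.mk a) *
      PowerSeries.mk (permSum t fun k : Fin (M + 1) => q ^ (M - (k : ℕ))) =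
      (1 - PowerSeries.C t) * PowerSeries.mk a := by
  have h1 := prod_mul_mk_eq_one hq h0 ha
  have h2 := congrArg (PowerSeries.rescale t) h1
  have h3 := mk_permSum_mul t fun k : Fin (M + 1) => q ^ (M - (k : ℕ))
  have h4 : PowerSeries.rescale t (∏ k : Fin (M + 1),
      (1 - PowerSeries.C (q ^ (M - (k : ℕ))) * PowerSeries.X)) =
      ∏ k : Fin (M + 1), (1 - PowerSeries.C (t * q ^ (M - (k : ℕ))) * PowerSeries.X) := by
    rw [map_prod]
    refine prod_congr rfl fun k _ => ?_
    rw [map_sub, map_one, map_mul, PowerSeries.rescale_X, rescale_C,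
      map_mul PowerSeries.C]
    ring
  rw [map_mul, map_one, h4] at h2
  set E := ∏ k : Fin (M + 1), (1 - PowerSeries.C (q ^ (M - (k : ℕ))) * PowerSeries.X)
  set E' := ∏ k : Fin (M + 1), (1 - PowerSeries.C (t * q ^ (M - (k : ℕ))) * PowerSeries.X)
  set h := PowerSeries.mk a
  set h' := PowerSeries.rescale t h
  set P := PowerSeries.mk (permSum t fun k : Fin (M + 1) => q ^ (M - (k : ℕ)))
  linear_combination h * h' * h3 - P * h' * h1 + (P * PowerSeries.C t * h +
    (1 - PowerSeries.C t) * h) * h2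

theorem permSum_mul_qPochhammer {q t : B} {M : ℕ} (hq : q ^ (M + 1) = 0) (n : ℕ) :
    permSum t (fun k : Fin (M + 1) => q ^ (M - (k : ℕ))) n * ∏ i ∈ Icc 1 n, (1 - q ^ i) =
      ∑ σ : Equiv.Perm (Fin n), q ^ (maj σ - exc σ) * t ^ exc σ := by
  rw [permSum, sum_mul]
  refine sum_congr rfl fun σ _ => ?_
  rw [mul_assoc, sum_compat_mul hq, ← sum_dexSet_add_exc σ, Nat.add_sub_cancel, mul_comm]
  intro i hi
  exact (mem_filter.1 hi).2.choose

end Truncation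

section Main

open Finset

variable (R : Type*) [CommRing R]

variable {R}

/-- Allows `q` to be treated as nilpotent: `R[[q]]` is separated for the `q`-adic filtration. -/
theorem eq_zero_of_map_mk (P : Polynomial (PowerSeries R))
    (hP : ∀ M, P.map (Ideal.Quotient.mk
      (Ideal.span {(PowerSeries.X : PowerSeries R) ^ (M + 1)})) = 0) : P = 0 := by
  ext i k
  have h1 := congrArg (fun P => Polynomial.coeff P i) (hP k)
  simp only [Polynomial.coeff_map, Polynomial.coeff_zero] at h1
  rw [Ideal.Quotient.eq_zero_iff_mem, Ideal.mem_span_singleton, PowerSeries.X_pow_dvd_iff] at h1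
  simpa using h1 k k.lt_succ_self

variable {B : Type*} [CommRing B] {M : ℕ} (φ : Polynomial (PowerSeries R) →+* B)

theorem map_normalizedEulerian (hφ : φ (Polynomial.C PowerSeries.X) ^ (M + 1) = 0) (n : ℕ) :
    φ (normalizedEulerian R n) =
      permSum (φ Polynomial.X) (fun k : Fin (M + 1) =>
        φ (Polynomial.C PowerSeries.X) ^ (M - (k : ℕ))) n := by
  set q := φ (Polynomial.C PowerSeries.X) with hq
  have h1 := permSum_mul_qPochhammer (t := φ Polynomial.X) hφ n
  have h2 : φ (Polynomial.C (qPochhammer R n)) = ∏ i ∈ Icc 1 n, (1 - q ^ i) := by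
    rw [qPochhammer, map_prod, map_prod]
    exact prod_congr rfl fun i _ => by rw [map_sub, map_sub, map_pow, map_pow, map_one, map_one]
  have h3 : φ (Polynomial.C (qPochhammer R n)) * φ (Polynomial.C (qPochhammerInv R n)) = 1 := by
    rw [← map_mul, ← map_mul, qPochhammer_mul_inv, map_one, map_one]
  have h4 : φ (Polynomial.map Polynomial.coeToPowerSeries.ringHom (qEulerian R n)) =
      ∑ σ : Equiv.Perm (Fin n), q ^ (maj σ - exc σ) * φ Polynomial.X ^ exc σ := by
    rw [qEulerian, Polynomial.map_sum, map_sum]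
    refine sum_congr rfl fun σ _ => ?_
    rw [Polynomial.map_mul, Polynomial.map_C, Polynomial.map_pow, Polynomial.map_X, map_mul,
      map_pow, map_pow, map_pow, map_pow, hq, Polynomial.coeToPowerSeries.ringHom_apply,
      Polynomial.coe_X]
  rw [normalizedEulerian, map_mul, h4, ← h1, ← h2, mul_assoc, h3, mul_one]

theorem map_qExp_mul_normalizedEulerian (hφ : φ (Polynomial.C PowerSeries.X) ^ (M + 1) = 0) :
    PowerSeries.map φ ((PowerSeries.rescale Polynomial.X (qExp R) -
      PowerSeries.C Polynomial.X * qExp R) * PowerSeries.mk (normalizedEulerian R)) =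
      PowerSeries.map φ (PowerSeries.C (1 - Polynomial.X) * qExp R) := by
  set q := φ (Polynomial.C PowerSeries.X) with hq
  set a : ℕ → B := fun n => φ (Polynomial.C (qPochhammerInv R n)) with ha
  have h0 : a 0 = 1 := by
    rw [ha]
    simp only
    rw [← ps_h, ps_h_zero, map_one, map_one]
  have hs : ∀ n, a (n + 1) = a n + q ^ (n + 1) * a (n + 1) := by
    intro n
    have := congrArg (fun s => φ (Polynomial.C s)) (ps_h_succ (R := R) n)
    simpa only [ps_h, map_add, map_mul, map_pow] using this
  have h1 : PowerSeries.map φ (qExp R) = PowerSeries.mk a := by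
    ext1 n
    rw [PowerSeries.coeff_map, qExp, PowerSeries.coeff_mk, PowerSeries.coeff_mk]
  have h2 : PowerSeries.map φ (PowerSeries.rescale Polynomial.X (qExp R)) =
      PowerSeries.rescale (φ Polynomial.X) (PowerSeries.mk a) := by
    ext1 n
    rw [← h1, PowerSeries.coeff_map, PowerSeries.coeff_rescale, PowerSeries.coeff_rescale,
      PowerSeries.coeff_map, map_mul, map_pow]
  have h3 : PowerSeries.map φ (PowerSeries.mk (normalizedEulerian R)) =
      PowerSeries.mk (permSum (φ Polynomial.X) fun k : Fin (M + 1) => q ^ (M - (k : ℕ))) := by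
    ext1 n
    rw [PowerSeries.coeff_map, PowerSeries.coeff_mk, PowerSeries.coeff_mk,
      map_normalizedEulerian φ hφ]
  rw [map_mul, map_sub, map_mul, map_mul, h1, h2, h3, PowerSeries.map_C, PowerSeries.map_C, map_sub,
    map_one, rescale_mul_permSum hφ h0 hs, map_sub, map_one]

theorem map_coeff_qExp_mul_normalizedEulerian {S : Type*} [CommRing S] (f : PowerSeries R →+* S)
    (hf : f PowerSeries.X ^ (M + 1) = 0) (n : ℕ) :
    (PowerSeries.coeff n ((PowerSeries.rescale Polynomial.X (qExp R) -
      PowerSeries.C Polynomial.X * qExp R) * PowerSeries.mk (normalizedEulerian R)) -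
      PowerSeries.coeff n (PowerSeries.C (1 - Polynomial.X) * qExp R)).map f = 0 := by
  have hq : Polynomial.mapRingHom f (Polynomial.C PowerSeries.X) ^ (M + 1) = 0 := by
    rw [Polynomial.coe_mapRingHom, Polynomial.map_C, ← Polynomial.C_pow, hf, Polynomial.C_0]
  have h1 := congrArg (PowerSeries.coeff n) (map_qExp_mul_normalizedEulerian _ hq)
  rwa [PowerSeries.coeff_map, PowerSeries.coeff_map, ← sub_eq_zero, ← map_sub] at h1

variable (R)

theorem qExp_mul_normalizedEulerian :
    (PowerSeries.rescale Polynomial.X (qExp R) - PowerSeries.C Polynomial.X * qExp R) *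
      PowerSeries.mk (normalizedEulerian R) = PowerSeries.C (1 - Polynomial.X) * qExp R := by
  ext1 n
  rw [← sub_eq_zero]
  refine eq_zero_of_map_mk _ fun M => map_coeff_qExp_mul_normalizedEulerian (M := M) _ ?_ n
  rw [← map_pow]
  exact Ideal.Quotient.eq_zero_iff_mem.2 (Ideal.mem_span_singleton_self _)

end Main

end EulerianSym

end

theorem corollary4p2 (R : Type*) [CommRing R] (n : ℕ) :
    EulerianSym.psPoly R (EulerianSym.Qtilde R n) =
      Polynomial.map Polynomial.coeToPowerSeries.ringHom (EulerianSym.qBinomialEulerian R n) *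
        Polynomial.C (EulerianSym.qPochhammerInv R n) :=
  EulerianSym.psPoly_Qtilde_of_psPoly_Q R n
    (EulerianSym.psPoly_Q_of_qExp R (EulerianSym.qExp_mul_normalizedEulerian R))
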